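/- **Setting.** Let $q>0$, $q\neq1$, and let $\mathfrak c_1,\mathfrak c_2,\mathfrak c_3\in\mathbb C$ with $(\mathfrak c_1,\mathfrak c_2)\neq(0,0)$. Consider the lattice $x(s)=\mathfrak c_1q^{-s}+\mathfrak c_2q^{s}+\mathfrak c_3$ ($s\in\mathbb C$). For $n\in\mathbb Z$ put $$\alpha_n=\frac{q^{n/2}+q^{-n/2}}2,\quad \gamma_n=\frac{q^{n/2}-q^{-n/2}}{q^{1/2}-q^{-1/2}},\quad \alpha=\alpha_1,\quad \beta=(1-\alpha)\mathfrak c_3,$$ $$\delta=\Big(\frac{x(0)+x(1)-2\beta(\alpha+1)}{2\alpha}\Big)^2-x(0)x(1),$$ $$\mathtt U_1(z)=(\alpha^2-1)z+\beta(\alpha+1),\quad \mathtt U_2(z)=(\alpha^2-1)z^2+2\beta(\alpha+1)z+\delta .$$ Let $\mathcal P=\mathbb C[z]$, let $\mathcal P_m$ be the space of polynomials of degree at most $m$, and let $\mathcal P^*$ be the algebraic dual of $\mathcal P$. The linear operators $\mathrm D_x,\mathrm S_x$ on $\mathcal P$ are determined by $$\mathrm D_xf(x(s))=\frac{f(x(s+\frac12))-f(x(s-\frac12))}{x(s+\frac12)-x(s-\frac12)},\qquad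 \mathrm S_xf(x(s))=\frac{f(x(s+\frac12))+f(x(s-\frac12))}{2}$$ (the first for all $s$ with $x(s+\frac12)\ne x(s-\frac12)$). For ${\bf u}\in\mathcal P^*$ and $g\in\mathcal P$ define functionals $g{\bf u}$, $\mathbf D_x{\bf u}$, $\mathbf S_x{\bf u}$ by $\langle g{\bf u},f\rangle=\langle{\bf u},gf\rangle$, $\langle\mathbf D_x{\bf u},f\rangle=-\langle{\bf u},\mathrm D_xf\rangle$, $\langle\mathbf S_x{\bf u},f\rangle=\langle{\bf u},\mathrm S_xf\rangle$. An orthogonal polynomial sequence (OPS) with respect to ${\bf u}$ is a sequence $(P_n)_{n\ge0}$ in $\mathcal P$ with $\deg P_n=n$ and $\langle{\bf u},P_nP_k\rangle=h_n\delta_{n,k}$ with $h_n\ne0$ for all $n,k\ge0$; ${\bf u}$ is regular if such an OPS exists. For $\phi(z)=az^2+bz+c$ and $\psi(z)=dz+e$ put, for $n\in\mathbb Z$, $$d_n=a\gamma_n+d\,\alpha_n,\qquad e_n=\phi'(\mathfrak c_3)\gamma_n+\psi(\mathfrak c_3)\alpha_n ;$$ $(\phi,\psi)$ is $x$-admissible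 if $d_n\neq0$ for all $n\ge0$. Put $\phi^{[0]}=\phi$, $\psi^{[0]}=\psi$, ${\bf u}^{[0]}={\bf u}$ and, for $k\ge0$, $$\phi^{[k+1]}=\mathrm S_x\phi^{[k]}+\mathtt U_1\mathrm S_x\psi^{[k]}+\alpha\mathtt U_2\mathrm D_x\psi^{[k]},\qquad \psi^{[k+1]}=\mathrm D_x\phi^{[k]}+\alpha\mathrm S_x\psi^{[k]}+\mathtt U_1\mathrm D_x\psi^{[k]},$$ $${\bf u}^{[k+1]}=\mathbf D_x\big(\mathtt U_2\psi^{[k]}{\bf u}^{[k]}\big)-\mathbf S_x\big(\phi^{[k]}{\bf u}^{[k]}\big).$$ **Theorem.** Let ${\bf u}\in\mathcal P^*\setminus\{\bf 0\}$ and $(\phi,\psi)\in\mathcal P_2\times\mathcal P_1\setminus\{(0,0)\}$ satisfy $\mathbf D_x(\phi{\bf u})=\mathbf S_x(\psi{\bf u})$. Then the following hold. 1. For all $k\ge0$, $$\psi^{[k]}(z)=(a\gamma_{2k}+d\alpha_{2k})(z-\mathfrak c_3)+\phi'(\mathfrak c_3)\gamma_k+\psi(\mathfrak c_3)\alpha_k,$$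 $$\phi^{[k]}(z)=\big(d(\alpha^2-1)\gamma_{2k}+a\alpha_{2k}\big)\big((z-\mathfrak c_3)^2-2\mathfrak c_1\mathfrak c_2\big)+\big(\phi'(\mathfrak c_3)\alpha_k+\psi(\mathfrak c_3)(\alpha^2-1)\gamma_k\big)(z-\mathfrak c_3)+\phi(\mathfrak c_3)+2a\mathfrak c_1\mathfrak c_2 .$$ 2. ${\bf u}$ is regular if and only if $(\phi,\psi)$ is $x$-admissible and $\psi^{[n]}\nmid\phi^{[n]}$ for all $n\ge0$. 3. Equivalently, ${\bf u}$ is regular if and only if $d_n\neq0$ and $\phi^{[n]}\big(\mathfrak c_3-\frac{e_n}{d_{2n}}\big)\neq0$ for all $n\ge0$. 4. If ${\bf u}$ is regular, there is exactly one monic OPS $(P_n)_{n\ge0}$ with respect to ${\bf u}$, and with $P_{-1}=0$ it satisfies $P_{n+1}(z)=(z-B_n)P_n(z)-C_nP_{n-1}(z)$ for $n\ge0$, where, for $n\ge0$, $$B_n=\mathfrak c_3+\frac{\gamma_ne_{n-1}}{d_{2n-2}}-\frac{\gamma_{n+1}e_n}{d_{2n}},\qquad C_{n+1}=-\frac{\gamma_{n+1}d_{n-1}}{d_{2n-1}d_{2n+1}}\,\phi^{[n]}\Big(\mathfrak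 c_3-\frac{e_n}{d_{2n}}\Big).$$ Here, for $n=0$, the term $\gamma_0e_{-1}/d_{-2}$ is read as $0$ and the quotient $d_{-1}/d_{-1}$ as $1$, even if $d_{-2}$ or $d_{-1}$ vanishes; thus $B_0=\mathfrak c_3-e_0/d_0$ and $C_1=-\phi(\mathfrak c_3-e_0/d_0)/d_1$. Moreover, the functional Rodrigues formula $$P_n{\bf u}=k_n\,\mathbf D_x^n{\bf u}^{[n]},\qquad k_n=(-\alpha)^{-n}\prod_{j=1}^nd_{n+j-2}^{-1}\qquad(n\ge0)$$ holds. -/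

import Mathlib

open Polynomial

/-- The parameters of a lattice `x(s) = c₁ q^{-s} + c₂ q^s + c₃` with `q > 0`, `q ≠ 1` and
`(c₁, c₂) ≠ (0, 0)` (a `q`-quadratic lattice if `c₁ c₂ ≠ 0`, a `q`-linear one if `c₁ c₂ = 0`). -/
structure QLattice where
  q : ℝ
  q_pos : 0 < q
  q_ne_one : q ≠ 1
  c₁ : ℂ
  c₂ : ℂ
  c₃ : ℂ
  nondegenerate : (c₁, c₂) ≠ (0, 0)

namespace QLattice

noncomputable section

/-- The lattice `x(s) = c₁ q^{-s} + c₂ q^s + c₃`, `s ∈ ℂ`. -/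
def x (L : QLattice) (s : ℂ) : ℂ :=
  L.c₁ * (L.q : ℂ) ^ (-s) + L.c₂ * (L.q : ℂ) ^ s + L.c₃

/-- `α_n = (q^{n/2} + q^{-n/2}) / 2`, for every integer `n`. -/
def alphaSeq (L : QLattice) (n : ℤ) : ℂ :=
  (((L.q ^ ((n : ℝ) / 2) + L.q ^ (-((n : ℝ) / 2))) / 2 : ℝ) : ℂ)

/-- `γ_n = (q^{n/2} - q^{-n/2}) / (q^{1/2} - q^{-1/2})`, for every integer `n`. -/
def gammaSeq (L : QLattice) (n : ℤ) : ℂ :=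
  (((L.q ^ ((n : ℝ) / 2) - L.q ^ (-((n : ℝ) / 2))) /
    (L.q ^ ((1 : ℝ) / 2) - L.q ^ (-((1 : ℝ) / 2))) : ℝ) : ℂ)

/-- `α = (q^{1/2} + q^{-1/2}) / 2`. -/
def alpha (L : QLattice) : ℂ :=
  (((L.q ^ ((1 : ℝ) / 2) + L.q ^ (-((1 : ℝ) / 2))) / 2 : ℝ) : ℂ)

/-- `β = (1 - α) c₃`. -/
def beta (L : QLattice) : ℂ := (1 - L.alpha) * L.c₃

/-- `δ = ((x(0) + x(1) - 2β(α+1)) / (2α))² - x(0) x(1)`. -/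
def delta (L : QLattice) : ℂ :=
  ((L.x 0 + L.x 1 - 2 * L.beta * (L.alpha + 1)) / (2 * L.alpha)) ^ 2 - L.x 0 * L.x 1

/-- `U₁(z) = (α² - 1) z + β (α + 1)`. -/
def U₁ (L : QLattice) : ℂ[X] :=
  C (L.alpha ^ 2 - 1) * X + C (L.beta * (L.alpha + 1))

/-- `U₂(z) = (α² - 1) z² + 2 β (α + 1) z + δ`. -/
def U₂ (L : QLattice) : ℂ[X] :=
  C (L.alpha ^ 2 - 1) * X ^ 2 + C (2 * L.beta * (L.alpha + 1)) * X + C L.delta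

/-! ### The operators `D_x` and `S_x` on polynomials -/

/-- `g` is the `x`-derivative of `f`:
`g(x(s)) = (f(x(s+1/2)) - f(x(s-1/2))) / (x(s+1/2) - x(s-1/2))`
for all `s` at which the denominator does not vanish. -/
def IsXDerivative (L : QLattice) (f g : ℂ[X]) : Prop :=
  ∀ s : ℂ, L.x (s + 1 / 2) - L.x (s - 1 / 2) ≠ 0 →
    g.eval (L.x s) =
      (f.eval (L.x (s + 1 / 2)) - f.eval (L.x (s - 1 / 2))) / (L.x (s + 1 / 2) - L.x (s - 1 / 2))

/-- `g` is the `x`-average of `f`: `g(x(s)) = (f(x(s+1/2)) + f(x(s-1/2))) / 2` for all `s`. -/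
def IsXAverage (L : QLattice) (f g : ℂ[X]) : Prop :=
  ∀ s : ℂ, g.eval (L.x s) = (f.eval (L.x (s + 1 / 2)) + f.eval (L.x (s - 1 / 2))) / 2

/-- `q^{1/2}` as a complex number. -/
def sqrtq (L : QLattice) : ℂ := (L.q : ℂ) ^ (1 / 2 : ℂ)

theorem q_ne_zero (L : QLattice) : (L.q : ℂ) ≠ 0 := by
  exact_mod_cast L.q_pos.ne'

theorem sqrtq_ne_zero (L : QLattice) : L.sqrtq ≠ 0 := by
  simp [sqrtq, Complex.cpow_eq_zero_iff, L.q_ne_zero]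

theorem sqrtq_eq (L : QLattice) : L.sqrtq = ((L.q ^ ((1 : ℝ) / 2) : ℝ) : ℂ) := by
  rw [sqrtq, Complex.ofReal_cpow L.q_pos.le]
  norm_num

theorem sqrtq_sub_inv_ne_zero (L : QLattice) : L.sqrtq - L.sqrtq⁻¹ ≠ 0 := by
  intro h
  have h0 := L.sqrtq_ne_zero
  have h1 : L.sqrtq ^ 2 = 1 := by
    field_simp at h
    linear_combination h
  have h2 : (L.q : ℂ) = 1 := by
    rw [← h1, sqrtq, sq, ← Complex.cpow_add _ _ L.q_ne_zero]
    norm_num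
  exact L.q_ne_one (by exact_mod_cast h2)

theorem alpha_eq (L : QLattice) : L.alpha = (L.sqrtq + L.sqrtq⁻¹) / 2 := by
  rw [alpha, Real.rpow_neg L.q_pos.le, sqrtq_eq]
  push_cast
  rfl

theorem x_eq (L : QLattice) (s : ℂ) :
    L.x s = L.c₁ * ((L.q : ℂ) ^ s)⁻¹ + L.c₂ * (L.q : ℂ) ^ s + L.c₃ := by
  rw [x, Complex.cpow_neg]

theorem x_add_half (L : QLattice) (s : ℂ) :
    L.x (s + 1 / 2) =
      L.c₁ * ((L.q : ℂ) ^ s * L.sqrtq)⁻¹ + L.c₂ * ((L.q : ℂ) ^ s * L.sqrtq) + L.c₃ := by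
  rw [x_eq, Complex.cpow_add _ _ L.q_ne_zero, sqrtq]

theorem x_sub_half (L : QLattice) (s : ℂ) :
    L.x (s - 1 / 2) =
      L.c₁ * ((L.q : ℂ) ^ s / L.sqrtq)⁻¹ + L.c₂ * ((L.q : ℂ) ^ s / L.sqrtq) + L.c₃ := by
  rw [x_eq, Complex.cpow_sub _ _ L.q_ne_zero, sqrtq]

theorem half_add (L : QLattice) (s : ℂ) :
    (L.x (s + 1 / 2) + L.x (s - 1 / 2)) / 2 = L.alpha * L.x s + L.beta := by
  have hw : (L.q : ℂ) ^ s ≠ 0 := by simp [Complex.cpow_eq_zero_iff, L.q_ne_zero]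
  have h0 := L.sqrtq_ne_zero
  rw [x_add_half, x_sub_half, x_eq, beta, alpha_eq]
  field_simp
  ring

theorem sq_half_sub (L : QLattice) (s : ℂ) :
    ((L.x (s + 1 / 2) - L.x (s - 1 / 2)) / 2) ^ 2 =
      (L.alpha ^ 2 - 1) * ((L.x s - L.c₃) ^ 2 - 4 * L.c₁ * L.c₂) := by
  have hw : (L.q : ℂ) ^ s ≠ 0 := by simp [Complex.cpow_eq_zero_iff, L.q_ne_zero]
  have h0 := L.sqrtq_ne_zero
  rw [x_add_half, x_sub_half, x_eq, alpha_eq]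
  field_simp
  ring

theorem sub_half_eq (L : QLattice) (s : ℂ) :
    L.x (s + 1 / 2) - L.x (s - 1 / 2) =
      (L.sqrtq - L.sqrtq⁻¹) * (L.c₂ * (L.q : ℂ) ^ s - L.c₁ * ((L.q : ℂ) ^ s)⁻¹) := by
  have hw : (L.q : ℂ) ^ s ≠ 0 := by simp [Complex.cpow_eq_zero_iff, L.q_ne_zero]
  have h0 := L.sqrtq_ne_zero
  rw [x_add_half, x_sub_half]
  field_simp
  ring

/-- The pair `(D_x z^n, S_x z^n)`; auxiliary, for the existence of `D_x` and `S_x`. -/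
def auxPair (L : QLattice) : ℕ → ℂ[X] × ℂ[X]
  | 0 => (0, 1)
  | n + 1 =>
    ((C L.alpha * X + C L.beta) * (L.auxPair n).1 + (L.auxPair n).2,
      C (L.alpha ^ 2 - 1) * ((X - C L.c₃) ^ 2 - C (4 * L.c₁ * L.c₂)) * (L.auxPair n).1 +
        (C L.alpha * X + C L.beta) * (L.auxPair n).2)

theorem auxPair_spec (L : QLattice) (n : ℕ) (s : ℂ) :
    (L.auxPair n).1.eval (L.x s) * (L.x (s + 1 / 2) - L.x (s - 1 / 2)) =
        L.x (s + 1 / 2) ^ n - L.x (s - 1 / 2) ^ n ∧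
      (L.auxPair n).2.eval (L.x s) = (L.x (s + 1 / 2) ^ n + L.x (s - 1 / 2) ^ n) / 2 := by
  induction n with
  | zero => simp [auxPair]
  | succ n ih =>
    obtain ⟨h1, h2⟩ := ih
    have ha := L.half_add s
    have hs := L.sq_half_sub s
    constructor
    · simp only [auxPair, eval_add, eval_mul, eval_C, eval_X, h2]
      rw [← ha]
      linear_combination ((L.x (s + 1 / 2) + L.x (s - 1 / 2)) / 2) * h1
    · simp only [auxPair, eval_add, eval_sub, eval_pow, eval_mul, eval_C, eval_X, h2]
      rw [← ha, ← hs]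
      linear_combination ((L.x (s + 1 / 2) - L.x (s - 1 / 2)) / 4) * h1

theorem exists_xDerivative (L : QLattice) :
    ∃ D : ℂ[X] →ₗ[ℂ] ℂ[X], ∀ f, L.IsXDerivative f (D f) := by
  refine ⟨Polynomial.lsum (fun n => LinearMap.toSpanSingleton ℂ ℂ[X] (L.auxPair n).1), ?_⟩
  intro f s hs
  rw [eq_div_iff hs]
  induction f using Polynomial.induction_on' with
  | add f g hf hg =>
    rw [map_add, eval_add, eval_add, eval_add]
    linear_combination hf + hg
  | monomial n a =>
    have h := (L.auxPair_spec n s).1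
    simp only [Polynomial.lsum_apply, LinearMap.toSpanSingleton_apply, zero_smul,
      Polynomial.sum_monomial_index, eval_smul, smul_eq_mul, eval_monomial]
    linear_combination a * h

theorem exists_xAverage (L : QLattice) :
    ∃ S : ℂ[X] →ₗ[ℂ] ℂ[X], ∀ f, L.IsXAverage f (S f) := by
  refine ⟨Polynomial.lsum (fun n => LinearMap.toSpanSingleton ℂ ℂ[X] (L.auxPair n).2), ?_⟩
  intro f s
  induction f using Polynomial.induction_on' with
  | add f g hf hg =>
    rw [map_add, eval_add, eval_add, eval_add]
    linear_combination hf + hg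
  | monomial n a =>
    have h := (L.auxPair_spec n s).2
    simp only [Polynomial.lsum_apply, LinearMap.toSpanSingleton_apply, zero_smul,
      Polynomial.sum_monomial_index, eval_smul, smul_eq_mul, eval_monomial]
    linear_combination a * h

/-- A polynomial is determined by its values at the points `x(s)` at which the quotient that
defines the `x`-derivative makes sense. -/
theorem eq_of_eval_x_eq (L : QLattice) {g h : ℂ[X]}
    (H : ∀ s : ℂ, L.x (s + 1 / 2) - L.x (s - 1 / 2) ≠ 0 → g.eval (L.x s) = h.eval (L.x s)) :
    g = h := by
  have hpos : ∀ t : ℝ, L.x ((t : ℂ) + 1 / 2) - L.x ((t : ℂ) - 1 / 2) = 0 ↔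
      L.c₂ * (((L.q ^ t : ℝ) : ℂ)) ^ 2 = L.c₁ := by
    intro t
    have hw : (L.q : ℂ) ^ (t : ℂ) ≠ 0 := by simp [Complex.cpow_eq_zero_iff, L.q_ne_zero]
    rw [sub_half_eq, mul_eq_zero, or_iff_right L.sqrtq_sub_inv_ne_zero,
      Complex.ofReal_cpow L.q_pos.le]
    rw [sub_eq_zero, ← div_eq_mul_inv, eq_div_iff hw, sq, mul_assoc]
  have hinj : Function.Injective (fun t : ℝ => ((L.q ^ t : ℝ) : ℂ)) := by
    intro a b hab
    have hab' : L.q ^ a = L.q ^ b := Complex.ofReal_injective hab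
    exact (Real.rpow_right_inj L.q_pos L.q_ne_one).1 hab'
  by_contra hne
  have hp : g - h ≠ 0 := sub_ne_zero.2 hne
  have key : (Set.univ : Set ℝ) ⊆
      (fun t : ℝ => ((L.q ^ t : ℝ) : ℂ)) ⁻¹'
        ({w | (C L.c₂ * X ^ 2 - C L.c₁ : ℂ[X]).IsRoot w} ∪
          ⋃ r ∈ ((g - h).roots.toFinset : Set ℂ),
            {w | (C L.c₂ * X ^ 2 + C (L.c₃ - r) * X + C L.c₁ : ℂ[X]).IsRoot w}) := by
    intro t _
    by_cases ht : L.x ((t : ℂ) + 1 / 2) - L.x ((t : ℂ) - 1 / 2) = 0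
    · left
      have := (hpos t).1 ht
      simp only [Set.mem_ofPred_eq, IsRoot.def, eval_sub, eval_mul, eval_C, eval_pow, eval_X]
      rw [this, sub_self]
    · right
      simp only [Set.mem_iUnion, Set.mem_ofPred_eq]
      refine ⟨L.x t, ?_, ?_⟩
      · simp only [Finset.mem_coe, Multiset.mem_toFinset]
        rw [mem_roots hp]
        simp [H t ht]
      · have hw : (L.q : ℂ) ^ (t : ℂ) ≠ 0 := by simp [Complex.cpow_eq_zero_iff, L.q_ne_zero]
        simp only [IsRoot.def, eval_add, eval_mul, eval_C, eval_pow, eval_X]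
        rw [x_eq, Complex.ofReal_cpow L.q_pos.le]
        field_simp
        ring
  have hnd : L.c₁ ≠ 0 ∨ L.c₂ ≠ 0 := by
    by_contra hc
    push Not at hc
    exact L.nondegenerate (by rw [hc.1, hc.2])
  have hfin : ((fun t : ℝ => ((L.q ^ t : ℝ) : ℂ)) ⁻¹'
        ({w | (C L.c₂ * X ^ 2 - C L.c₁ : ℂ[X]).IsRoot w} ∪
          ⋃ r ∈ ((g - h).roots.toFinset : Set ℂ),
            {w | (C L.c₂ * X ^ 2 + C (L.c₃ - r) * X + C L.c₁ : ℂ[X]).IsRoot w})).Finite := by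
    refine Set.Finite.preimage hinj.injOn ?_
    refine Set.Finite.union (finite_setOfPred_isRoot ?_)
      (Set.Finite.biUnion (Finset.finite_toSet _) fun r _ => finite_setOfPred_isRoot ?_)
    · intro h0
      have e0 := congrArg (fun p : ℂ[X] => p.coeff 0) h0
      have e2 := congrArg (fun p : ℂ[X] => p.coeff 2) h0
      simp [coeff_X_pow, coeff_C] at e0 e2
      rcases hnd with h | h
      · exact h e0
      · exact h e2
    · intro h0
      have e0 := congrArg (fun p : ℂ[X] => p.coeff 0) h0
      have e2 := congrArg (fun p : ℂ[X] => p.coeff 2) h0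
      simp [coeff_X_pow, coeff_C, coeff_X] at e0 e2
      rcases hnd with h | h
      · exact h e0
      · exact h e2
  exact Set.infinite_univ (hfin.subset key)

/-- The `x`-derivative operator `D_x` on polynomials. -/
def Dx (L : QLattice) : ℂ[X] →ₗ[ℂ] ℂ[X] := Classical.choose L.exists_xDerivative

/-- The `x`-average operator `S_x` on polynomials. -/
def Sx (L : QLattice) : ℂ[X] →ₗ[ℂ] ℂ[X] := Classical.choose L.exists_xAverage

/-- `D_x f` is the one and only polynomial that satisfies the defining relation. -/
theorem isXDerivative_iff (L : QLattice) (f g : ℂ[X]) : L.IsXDerivative f g ↔ g = L.Dx f := by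
  have h := Classical.choose_spec L.exists_xDerivative f
  refine ⟨fun hg => L.eq_of_eval_x_eq fun s hs => ?_, fun hg => hg ▸ h⟩
  rw [hg s hs]
  exact (h s hs).symm

/-- `S_x f` is the one and only polynomial that satisfies the defining relation. -/
theorem isXAverage_iff (L : QLattice) (f g : ℂ[X]) : L.IsXAverage f g ↔ g = L.Sx f := by
  have h := Classical.choose_spec L.exists_xAverage f
  refine ⟨fun hg => L.eq_of_eval_x_eq fun s _ => ?_, fun hg => hg ▸ h⟩
  rw [hg s]
  exact (h s).symm

/-! ### Functionals -/

/-- Left multiplication of a functional by a polynomial: `⟨f u, g⟩ = ⟨u, f g⟩`. -/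
def mulF (f : ℂ[X]) (u : Module.Dual ℂ ℂ[X]) : Module.Dual ℂ ℂ[X] :=
  u ∘ₗ LinearMap.mulLeft ℂ f

/-- The `x`-derivative of a functional: `⟨D_x u, f⟩ = -⟨u, D_x f⟩`. -/
def DxF (L : QLattice) (u : Module.Dual ℂ ℂ[X]) : Module.Dual ℂ ℂ[X] := -(u ∘ₗ L.Dx)

/-- The `x`-average of a functional: `⟨S_x u, f⟩ = ⟨u, S_x f⟩`. -/
def SxF (L : QLattice) (u : Module.Dual ℂ ℂ[X]) : Module.Dual ℂ ℂ[X] := u ∘ₗ L.Sx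

/-- `(P_n)` is an orthogonal polynomial sequence with respect to `u`. -/
def IsOPS (u : Module.Dual ℂ ℂ[X]) (P : ℕ → ℂ[X]) : Prop :=
  (∀ n, (P n).degree = n) ∧
    ∃ h : ℕ → ℂ, (∀ n, h n ≠ 0) ∧ ∀ n k, u (P n * P k) = if n = k then h n else 0

/-- `(P_n)` is a monic orthogonal polynomial sequence with respect to `u`. -/
def IsMonicOPS (u : Module.Dual ℂ ℂ[X]) (P : ℕ → ℂ[X]) : Prop :=
  IsOPS u P ∧ ∀ n, (P n).Monic

/-- `u` is regular (quasi-definite). -/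
def IsRegular (u : Module.Dual ℂ ℂ[X]) : Prop := ∃ P : ℕ → ℂ[X], IsOPS u P

/-! ### The data attached to a pair `(φ, ψ)`, with `deg φ ≤ 2` and `deg ψ ≤ 1` -/

/-- `d_n = φ''/2 · γ_n + ψ' α_n`. -/
def d (L : QLattice) (φ ψ : ℂ[X]) (n : ℤ) : ℂ :=
  φ.coeff 2 * L.gammaSeq n + ψ.coeff 1 * L.alphaSeq n

/-- `e_n = φ'(c₃) γ_n + ψ(c₃) α_n`. -/
def e (L : QLattice) (φ ψ : ℂ[X]) (n : ℤ) : ℂ :=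
  (derivative φ).eval L.c₃ * L.gammaSeq n + ψ.eval L.c₃ * L.alphaSeq n

/-- `(φ, ψ)` is an `x`-admissible pair. -/
def IsAdmissible (L : QLattice) (φ ψ : ℂ[X]) : Prop := ∀ n : ℕ, L.d φ ψ n ≠ 0

/-- The pair `(φ^{[k]}, ψ^{[k]})`, defined recursively. -/
def pairIter (L : QLattice) (φ ψ : ℂ[X]) : ℕ → ℂ[X] × ℂ[X]
  | 0 => (φ, ψ)
  | k + 1 =>
    (L.Sx (L.pairIter φ ψ k).1 + L.U₁ * L.Sx (L.pairIter φ ψ k).2 +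
        C L.alpha * L.U₂ * L.Dx (L.pairIter φ ψ k).2,
      L.Dx (L.pairIter φ ψ k).1 + C L.alpha * L.Sx (L.pairIter φ ψ k).2 +
        L.U₁ * L.Dx (L.pairIter φ ψ k).2)

/-- `φ^{[k]}`. -/
def phiIter (L : QLattice) (φ ψ : ℂ[X]) (k : ℕ) : ℂ[X] := (L.pairIter φ ψ k).1

/-- `ψ^{[k]}`. -/
def psiIter (L : QLattice) (φ ψ : ℂ[X]) (k : ℕ) : ℂ[X] := (L.pairIter φ ψ k).2

/-- The closed form of `φ^{[k]}`. -/
def phiExplicit (L : QLattice) (φ ψ : ℂ[X]) (k : ℕ) : ℂ[X] :=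
  C (ψ.coeff 1 * (L.alpha ^ 2 - 1) * L.gammaSeq (2 * k) + φ.coeff 2 * L.alphaSeq (2 * k)) *
      ((X - C L.c₃) ^ 2 - C (2 * L.c₁ * L.c₂)) +
    C ((derivative φ).eval L.c₃ * L.alphaSeq k +
        ψ.eval L.c₃ * (L.alpha ^ 2 - 1) * L.gammaSeq k) * (X - C L.c₃) +
    C (φ.eval L.c₃ + 2 * φ.coeff 2 * L.c₁ * L.c₂)

/-- The closed form of `ψ^{[k]}`. -/
def psiExplicit (L : QLattice) (φ ψ : ℂ[X]) (k : ℕ) : ℂ[X] :=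
  C (φ.coeff 2 * L.gammaSeq (2 * k) + ψ.coeff 1 * L.alphaSeq (2 * k)) * (X - C L.c₃) +
    C ((derivative φ).eval L.c₃ * L.gammaSeq k + ψ.eval L.c₃ * L.alphaSeq k)

/-- The functionals `u^{[k]}`: `u^{[0]} = u` and
`u^{[k+1]} = D_x(U₂ ψ^{[k]} u^{[k]}) - S_x(φ^{[k]} u^{[k]})`. -/
def uIter (L : QLattice) (φ ψ : ℂ[X]) (u : Module.Dual ℂ ℂ[X]) : ℕ → Module.Dual ℂ ℂ[X]
  | 0 => u
  | k + 1 =>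
    L.DxF (mulF (L.U₂ * L.psiIter φ ψ k) (L.uIter φ ψ u k)) -
      L.SxF (mulF (L.phiIter φ ψ k) (L.uIter φ ψ u k))

/-- The recurrence coefficient `B_n = c₃ + γ_n e_{n-1} / d_{2n-2} - γ_{n+1} e_n / d_{2n}`; the
second summand is `0` for `n = 0`, as `γ_0 = 0`. -/
def recB (L : QLattice) (φ ψ : ℂ[X]) (n : ℕ) : ℂ :=
  L.c₃ + L.gammaSeq n * L.e φ ψ (n - 1) / L.d φ ψ (2 * n - 2) -
    L.gammaSeq (n + 1) * L.e φ ψ n / L.d φ ψ (2 * n)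

/-- The recurrence coefficient
`C_{n+1} = -(γ_{n+1} d_{n-1} / (d_{2n-1} d_{2n+1})) φ^{[n]}(c₃ - e_n / d_{2n})`, as a function
of `n`. For `n = 0` the factor `d_{n-1} / d_{2n-1} = d_{-1} / d_{-1}` is read as `1`, also when
`d_{-1} = 0`. -/
def recC (L : QLattice) (φ ψ : ℂ[X]) (n : ℕ) : ℂ :=
  -(L.gammaSeq (n + 1) * (if n = 0 then 1 else L.d φ ψ (n - 1) / L.d φ ψ (2 * n - 1)) /
      L.d φ ψ (2 * n + 1)) *
    (L.phiIter φ ψ n).eval (L.c₃ - L.e φ ψ n / L.d φ ψ (2 * n))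

/-- `k_n = (-α)^{-n} ∏_{j=1}^n d_{n+j-2}^{-1}`. -/
def rodriguesConst (L : QLattice) (φ ψ : ℂ[X]) (n : ℕ) : ℂ :=
  ((-L.alpha) ^ n)⁻¹ * ∏ j ∈ Finset.Icc 1 n, (L.d φ ψ ((n : ℤ) + (j : ℤ) - 2))⁻¹

end

end QLattice

/-!
Put `L f = φ D_x f + ψ S_x f`. The equation `D_x(φ u) = S_x(ψ u)` says that `u` annihilates the
range of `L`. With `L_k` the operator of the pair `(φ^{[k]}, ψ^{[k]})`, so that `L_0 = L`, two
polynomial identities carry the whole argument. Both come from the product rules for `D_x` and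
`S_x` and the commutation rules for `D_x S_x` and `S_x S_x`.

* `mul_Dx_pearsonOp_add`: `U₂ ψ D_x(L_1 f) + φ S_x(L_1 f)` lies in the range of `L`. Hence
  `u^{[1]}` annihilates the range of `L_1`, and inductively `u^{[k]}` annihilates the range of
  `L_k` (`uIter_pearsonOp`).
* `mul_Dx_mul_Dx_add`: `U₂ ψ D_x(f D_x g) + φ S_x(f D_x g) + α g L f` lies in the range of `L`.
  Hence `⟨u^{[k+1]}, f D_x g⟩ = α ⟨u^{[k]}, g L_k f⟩`, that is,
  `D_x(f u^{[k+1]}) = -α (L_k f) u^{[k]}` (`uIter_succ_mul_Dx`).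

Iterating the second one gives `D_x^n u^{[n]} = (-α)^n R_n u` with `R_n = L_0 L_1 ⋯ L_{n-1} 1`
(`iterate_DxF_uIter`). Since `D_x` lowers degrees by one, `R_n u` vanishes on polynomials of
degree less than `n`. On leading terms in powers of `z - c₃` one has
`L_k (z - c₃)^m = d_{m+2k} (z - c₃)^{m+1} + e_{m+k} (z - c₃)^m + ⋯`, so for an admissible pair
`R_n` has degree `n`, and its two highest coefficients are explicit (`rodriguesPoly_sub_mem`). So the normalized `R_n` are the monic
orthogonal polynomials provided that no `⟨u^{[n]}, 1⟩` vanishes. Evaluating `u^{[n]}` on `L_n 1`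
and `L_n (z - c₃)` yields
`⟨u^{[n+1]}, 1⟩ = -α (d_{2n} / d_{2n+1}) φ^{[n]}(c₃ - e_n / d_{2n}) ⟨u^{[n]}, 1⟩`
(`uIter_succ_one`), from which the regularity criterion and the coefficients
`C_{n+1}` follow. The coefficients `B_n` are differences of subleading coefficients.

It remains to see that regularity forces admissibility (`IsOPS.isAdmissible`). If `d_n = 0`, put
`w = D_x P_{n+1}`. Then `L w` has degree at most `n` and is orthogonal to all polynomials of
degree at most `n`, so `L w = 0`. Thus `w u^{[1]} = 0`, and therefore also `L (w (z - c₃)) = 0`.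
The two equations form a linear system for `(φ, ψ)` whose determinant, up to sign, is
`(S_x w)² - U₂ (D_x w)² ≠ 0` (`Sx_sq_sub_ne_zero`), so `φ = ψ = 0`.
-/

namespace QLattice

/-! ### The sequences `α_n` and `γ_n` -/

theorem alphaSeq_zero (L : QLattice) : L.alphaSeq 0 = 1 := by
  simp [alphaSeq]

theorem gammaSeq_zero (L : QLattice) : L.gammaSeq 0 = 0 := by
  simp [gammaSeq]

theorem alphaSeq_one (L : QLattice) : L.alphaSeq 1 = L.alpha := by
  simp [alphaSeq, alpha]

theorem sqrt_sub_inv_sqrt_ne_zero (L : QLattice) :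
    L.q ^ ((1 : ℝ) / 2) - L.q ^ (-((1 : ℝ) / 2)) ≠ 0 := by
  intro h
  have := (Real.rpow_right_inj L.q_pos L.q_ne_one).1 (sub_eq_zero.1 h)
  norm_num at this

theorem gammaSeq_one (L : QLattice) : L.gammaSeq 1 = 1 := by
  have := L.sqrt_sub_inv_sqrt_ne_zero
  simp only [gammaSeq, Int.cast_one, div_self this, Complex.ofReal_one]

theorem alphaSeq_neg (L : QLattice) (n : ℤ) : L.alphaSeq (-n) = L.alphaSeq n := by
  simp only [alphaSeq, Int.cast_neg, neg_div, neg_neg, add_comm]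

theorem gammaSeq_neg (L : QLattice) (n : ℤ) : L.gammaSeq (-n) = -L.gammaSeq n := by
  simp only [gammaSeq, Int.cast_neg, neg_div, neg_neg]
  rw [← Complex.ofReal_neg]
  congr 1
  ring

theorem gammaSeq_ne_zero (L : QLattice) {n : ℤ} (hn : n ≠ 0) : L.gammaSeq n ≠ 0 := by
  rw [gammaSeq, Complex.ofReal_ne_zero]
  refine div_ne_zero (fun h => hn ?_) L.sqrt_sub_inv_sqrt_ne_zero
  have := (Real.rpow_right_inj L.q_pos L.q_ne_one).1 (sub_eq_zero.1 h)
  have h' : (n : ℝ) = 0 := by linarith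
  exact_mod_cast h'

theorem alpha_ne_zero (L : QLattice) : L.alpha ≠ 0 := by
  have h1 := Real.rpow_pos_of_pos L.q_pos ((1 : ℝ) / 2)
  have h2 := Real.rpow_pos_of_pos L.q_pos (-((1 : ℝ) / 2))
  rw [alpha, Complex.ofReal_ne_zero]
  positivity

theorem alphaSeq_add (L : QLattice) (m n : ℤ) :
    L.alphaSeq (m + n) =
      L.alphaSeq m * L.alphaSeq n + (L.alpha ^ 2 - 1) * (L.gammaSeq m * L.gammaSeq n) := by
  have h := L.sqrt_sub_inv_sqrt_ne_zero
  have h1 : L.q ^ ((1 : ℝ) / 2) * L.q ^ (-((1 : ℝ) / 2)) = 1 := by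
    rw [← Real.rpow_add L.q_pos]; simp
  simp only [alphaSeq, gammaSeq, alpha]
  norm_cast
  push_cast
  rw [add_div (m : ℝ), neg_add, Real.rpow_add L.q_pos, Real.rpow_add L.q_pos]
  generalize L.q ^ ((m : ℝ) / 2) = a
  generalize L.q ^ (-((m : ℝ) / 2)) = b
  generalize L.q ^ ((n : ℝ) / 2) = c
  generalize L.q ^ (-((n : ℝ) / 2)) = d
  have h2 : ((L.q ^ ((1 : ℝ) / 2) + L.q ^ (-((1 : ℝ) / 2))) / 2) ^ 2 - 1 =
      ((L.q ^ ((1 : ℝ) / 2) - L.q ^ (-((1 : ℝ) / 2))) / 2) ^ 2 := by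
    linear_combination h1
  rw [h2]
  field_simp
  ring

theorem gammaSeq_add (L : QLattice) (m n : ℤ) :
    L.gammaSeq (m + n) = L.gammaSeq m * L.alphaSeq n + L.alphaSeq m * L.gammaSeq n := by
  have h := L.sqrt_sub_inv_sqrt_ne_zero
  simp only [alphaSeq, gammaSeq]
  norm_cast
  push_cast
  rw [add_div (m : ℝ), neg_add, Real.rpow_add L.q_pos, Real.rpow_add L.q_pos]
  field_simp
  ring

/-- A form of `cosh² - sinh² = 1`. -/
theorem alphaSeq_sq (L : QLattice) (n : ℤ) :
    L.alphaSeq n ^ 2 - (L.alpha ^ 2 - 1) * L.gammaSeq n ^ 2 = 1 := by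
  have h := L.alphaSeq_add n (-n)
  rw [add_neg_cancel, alphaSeq_zero, alphaSeq_neg, gammaSeq_neg] at h
  linear_combination -h

/-! ### The calculus of `D_x` and `S_x` -/

/-- The lattice coordinate `z - c₃`, with respect to which `D_x` and `S_x` respect parity. -/
noncomputable def Y (L : QLattice) : ℂ[X] := X - C L.c₃

theorem U₁_eq (L : QLattice) : L.U₁ = (C L.alpha ^ 2 - 1) * L.Y := by
  rw [U₁, Y, beta]
  simp only [map_sub, map_mul, map_add, map_pow, map_one]
  ring

theorem U₂_eq (L : QLattice) :
    L.U₂ = (C L.alpha ^ 2 - 1) * (L.Y ^ 2 - C (4 * L.c₁ * L.c₂)) := by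
  have hδ : L.delta = (L.alpha ^ 2 - 1) * (L.c₃ ^ 2 - 4 * L.c₁ * L.c₂) := by
    have h0 := L.sqrtq_ne_zero
    have hq : (L.q : ℂ) = L.sqrtq ^ 2 := by
      rw [sq, sqrtq, ← Complex.cpow_add _ _ L.q_ne_zero]
      norm_num
    have ha : L.sqrtq ^ 2 + 1 ≠ 0 := by
      intro h
      apply L.alpha_ne_zero
      rw [alpha_eq]
      field_simp
      rw [h, mul_zero]
    rw [delta, x_eq, x_eq, beta, alpha_eq, Complex.cpow_zero, Complex.cpow_one, hq]
    field_simp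
    ring
  rw [U₂, Y, hδ, beta]
  simp only [map_sub, map_mul, map_add, map_pow, map_one, map_ofNat]
  ring

theorem eval_U₂_x (L : QLattice) (s : ℂ) :
    L.U₂.eval (L.x s) = ((L.x (s + 1 / 2) - L.x (s - 1 / 2)) / 2) ^ 2 := by
  rw [sq_half_sub, U₂_eq, Y]
  simp

theorem eval_Sx (L : QLattice) (f : ℂ[X]) (s : ℂ) :
    (L.Sx f).eval (L.x s) = (f.eval (L.x (s + 1 / 2)) + f.eval (L.x (s - 1 / 2))) / 2 :=
  (L.isXAverage_iff f _).2 rfl s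

theorem eval_Dx (L : QLattice) (f : ℂ[X]) {s : ℂ} (hs : L.x (s + 1 / 2) - L.x (s - 1 / 2) ≠ 0) :
    (L.Dx f).eval (L.x s) =
      (f.eval (L.x (s + 1 / 2)) - f.eval (L.x (s - 1 / 2))) /
        (L.x (s + 1 / 2) - L.x (s - 1 / 2)) :=
  (L.isXDerivative_iff f _).2 rfl s hs

theorem Dx_mul (L : QLattice) (f g : ℂ[X]) :
    L.Dx (f * g) = L.Dx f * L.Sx g + L.Sx f * L.Dx g := by
  refine L.eq_of_eval_x_eq fun s hs => ?_
  simp only [eval_add, eval_mul, L.eval_Dx _ hs, eval_Sx]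
  field_simp
  ring

theorem Sx_mul (L : QLattice) (f g : ℂ[X]) :
    L.Sx (f * g) = L.Sx f * L.Sx g + L.U₂ * (L.Dx f * L.Dx g) := by
  refine L.eq_of_eval_x_eq fun s hs => ?_
  simp only [eval_add, eval_mul, L.eval_Dx _ hs, eval_Sx, eval_U₂_x]
  generalize L.x (s + 1 / 2) - L.x (s - 1 / 2) = w at hs ⊢
  field_simp
  ring

theorem Dx_C (L : QLattice) (a : ℂ) : L.Dx (C a) = 0 :=
  L.eq_of_eval_x_eq fun s hs => by simp [L.eval_Dx _ hs]

theorem Sx_C (L : QLattice) (a : ℂ) : L.Sx (C a) = C a :=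
  L.eq_of_eval_x_eq fun s hs => by simp [L.eval_Sx]

theorem Dx_one (L : QLattice) : L.Dx 1 = 0 := L.Dx_C 1

theorem Sx_one (L : QLattice) : L.Sx 1 = 1 := L.Sx_C 1

theorem Dx_Y (L : QLattice) : L.Dx L.Y = 1 :=
  L.eq_of_eval_x_eq fun s hs => by
    rw [L.eval_Dx _ hs, eval_one, div_eq_one_iff_eq hs]
    simp [Y]

theorem Sx_Y (L : QLattice) : L.Sx L.Y = C L.alpha * L.Y :=
  L.eq_of_eval_x_eq fun s hs => by
    have := L.half_add s
    rw [beta] at this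
    simp only [eval_Sx, Y, eval_sub, eval_X, eval_C, eval_mul]
    linear_combination this

theorem Dx_C_mul (L : QLattice) (a : ℂ) (f : ℂ[X]) : L.Dx (C a * f) = C a * L.Dx f := by
  rw [Dx_mul, Dx_C, Sx_C]; ring

theorem Sx_C_mul (L : QLattice) (a : ℂ) (f : ℂ[X]) : L.Sx (C a * f) = C a * L.Sx f := by
  rw [Sx_mul, Dx_C, Sx_C]; ring

/-- The commutation rules for `D_x` and `S_x`. -/
theorem Dx_Sx_and_Sx_Sx (L : QLattice) (f : ℂ[X]) :
    L.Dx (L.Sx f) = C L.alpha * L.Sx (L.Dx f) + L.U₁ * L.Dx (L.Dx f) ∧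
    L.Sx (L.Sx f) = f + L.U₁ * L.Sx (L.Dx f) + C L.alpha * L.U₂ * L.Dx (L.Dx f) := by
  induction f using Polynomial.induction_on with
  | C a => simp [Dx_C, Sx_C]
  | add f g hf hg =>
    obtain ⟨⟨h1, h2⟩, h3, h4⟩ := And.intro hf hg
    simp only [map_add, h1, h2, h3, h4]
    constructor <;> ring
  | monomial n a hf =>
    have e : (C a * X ^ (n + 1) : ℂ[X]) = (L.Y + C L.c₃) * (C a * X ^ n) := by
      rw [Y]; ring
    rw [e]
    generalize (C a * X ^ n : ℂ[X]) = f at hf ⊢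
    obtain ⟨h1, h2⟩ := hf
    have e1 : L.Dx ((L.Y + C L.c₃) * f) = L.Sx f + (C L.alpha * L.Y + C L.c₃) * L.Dx f := by
      rw [Dx_mul, map_add, map_add, Dx_Y, Sx_Y, Dx_C, Sx_C, add_zero, one_mul]
    have e2 : L.Sx ((L.Y + C L.c₃) * f) =
        (C L.alpha * L.Y + C L.c₃) * L.Sx f + L.U₂ * L.Dx f := by
      rw [Sx_mul, map_add, map_add, Dx_Y, Sx_Y, Dx_C, Sx_C, add_zero, one_mul]
    simp only [e1, e2, map_add, Dx_mul, Sx_mul, Dx_C, Sx_C, Dx_Y, Sx_Y, h1, h2,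
      U₁_eq, U₂_eq, map_sub, map_mul, Dx_one, Sx_one, sq]
    constructor <;> ring

/-! ### The adjoint form of the functional equation -/

/-- The operator `f ↦ φ D_x f + ψ S_x f`. The equation `D_x(φ u) = S_x(ψ u)` says that `u`
annihilates its range. -/
noncomputable def pearsonOp (L : QLattice) (φ ψ : ℂ[X]) : ℂ[X] →ₗ[ℂ] ℂ[X] :=
  LinearMap.mulLeft ℂ φ ∘ₗ L.Dx + LinearMap.mulLeft ℂ ψ ∘ₗ L.Sx

theorem pearsonOp_apply (L : QLattice) (φ ψ f : ℂ[X]) :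
    L.pearsonOp φ ψ f = φ * L.Dx f + ψ * L.Sx f := rfl

theorem apply_pearsonOp_eq_zero (L : QLattice) {φ ψ : ℂ[X]} {u : Module.Dual ℂ ℂ[X]}
    (h : L.DxF (mulF φ u) = L.SxF (mulF ψ u)) (f : ℂ[X]) : u (L.pearsonOp φ ψ f) = 0 := by
  have h' := LinearMap.congr_fun h f
  simp only [DxF, SxF, mulF, LinearMap.neg_apply, LinearMap.comp_apply,
    LinearMap.mulLeft_apply] at h'
  rw [pearsonOp_apply, map_add, ← h', add_neg_cancel]

/-- Modulo the range of the operator of `(φ, ψ)`, the adjoint `h ↦ U₂ ψ D_x h + φ S_x h` of the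
passage from `u` to `-u^{[1]}` sends `f D_x g` to `-α g (φ D_x f + ψ S_x f)`. -/
theorem mul_Dx_mul_Dx_add (L : QLattice) (φ ψ f g : ℂ[X]) :
    L.U₂ * ψ * L.Dx (f * L.Dx g) + φ * L.Sx (f * L.Dx g) +
        C L.alpha * (g * L.pearsonOp φ ψ f) =
      L.pearsonOp φ ψ (f * (C L.alpha * L.Sx g - L.U₁ * L.Dx g)) := by
  simp only [pearsonOp_apply, Dx_mul, Sx_mul, map_sub, Dx_C, Sx_C, Dx_Y, Sx_Y,
    (L.Dx_Sx_and_Sx_Sx g).1, (L.Dx_Sx_and_Sx_Sx g).2, U₁_eq, U₂_eq, Dx_one, Sx_one, sq]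
  ring

/-- The adjoint `h ↦ U₂ ψ D_x h + φ S_x h` of the passage from `u` to `-u^{[1]}` maps the range of
the operator of the pair `(φ', ψ') = (φ^{[1]}, ψ^{[1]})` into that of the operator of `(φ, ψ)`. In
terms of the shifts `E^{±1} = S_x ± (Δ/2) D_x` with `Δ = x(s + 1/2) - x(s - 1/2)`, the reason is
that `φ' ± (Δ/2) ψ' = E^{±1} (φ ± (Δ/2) ψ)`. -/
theorem mul_Dx_pearsonOp_add (L : QLattice) (φ ψ φ' ψ' f : ℂ[X])
    (hφ : φ' = L.Sx φ + L.U₁ * L.Sx ψ + C L.alpha * L.U₂ * L.Dx ψ)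
    (hψ : ψ' = L.Dx φ + C L.alpha * L.Sx ψ + L.U₁ * L.Dx ψ) :
    L.U₂ * ψ * L.Dx (L.pearsonOp φ' ψ' f) + φ * L.Sx (L.pearsonOp φ' ψ' f) =
      L.pearsonOp φ ψ (C L.alpha * (φ' * L.Sx f + L.U₂ * ψ' * L.Dx f) -
        L.U₁ * L.pearsonOp φ' ψ' f) := by
  subst hφ hψ
  simp only [pearsonOp_apply, Dx_mul, Sx_mul, map_sub, map_add, Dx_C, Sx_C, Dx_Y, Sx_Y,
    (L.Dx_Sx_and_Sx_Sx f).1, (L.Dx_Sx_and_Sx_Sx f).2, (L.Dx_Sx_and_Sx_Sx φ).1,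
    (L.Dx_Sx_and_Sx_Sx φ).2, (L.Dx_Sx_and_Sx_Sx ψ).1, (L.Dx_Sx_and_Sx_Sx ψ).2,
    U₁_eq, U₂_eq, Dx_one, Sx_one, sq]
  ring

/-! ### The iterated functionals and the Rodrigues formula -/

theorem phiIter_succ (L : QLattice) (φ ψ : ℂ[X]) (k : ℕ) :
    L.phiIter φ ψ (k + 1) = L.Sx (L.phiIter φ ψ k) + L.U₁ * L.Sx (L.psiIter φ ψ k) +
      C L.alpha * L.U₂ * L.Dx (L.psiIter φ ψ k) := rfl

theorem psiIter_succ (L : QLattice) (φ ψ : ℂ[X]) (k : ℕ) :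
    L.psiIter φ ψ (k + 1) = L.Dx (L.phiIter φ ψ k) + C L.alpha * L.Sx (L.psiIter φ ψ k) +
      L.U₁ * L.Dx (L.psiIter φ ψ k) := rfl

theorem uIter_succ_apply (L : QLattice) (φ ψ : ℂ[X]) (u : Module.Dual ℂ ℂ[X]) (k : ℕ)
    (f : ℂ[X]) : L.uIter φ ψ u (k + 1) f =
      -L.uIter φ ψ u k (L.U₂ * L.psiIter φ ψ k * L.Dx f + L.phiIter φ ψ k * L.Sx f) := by
  simp only [uIter, DxF, SxF, mulF, LinearMap.sub_apply, LinearMap.neg_apply,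
    LinearMap.comp_apply, LinearMap.mulLeft_apply, map_add]
  ring

/-- Each `u^{[k]}` satisfies the functional equation of the pair `(φ^{[k]}, ψ^{[k]})`. -/
theorem uIter_pearsonOp (L : QLattice) {φ ψ : ℂ[X]} {u : Module.Dual ℂ ℂ[X]}
    (h : ∀ f, u (L.pearsonOp φ ψ f) = 0) (k : ℕ) (f : ℂ[X]) :
    L.uIter φ ψ u k (L.pearsonOp (L.phiIter φ ψ k) (L.psiIter φ ψ k) f) = 0 := by
  induction k generalizing f with
  | zero => exact h f
  | succ k ih =>
    rw [uIter_succ_apply, L.mul_Dx_pearsonOp_add _ _ _ _ _ (L.phiIter_succ φ ψ k)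
      (L.psiIter_succ φ ψ k), ih, neg_zero]

/-- In terms of functionals, `D_x(f u^{[k+1]}) = -α (φ^{[k]} D_x f + ψ^{[k]} S_x f) u^{[k]}`. -/
theorem uIter_succ_mul_Dx (L : QLattice) {φ ψ : ℂ[X]} {u : Module.Dual ℂ ℂ[X]}
    (h : ∀ f, u (L.pearsonOp φ ψ f) = 0) (k : ℕ) (f g : ℂ[X]) :
    L.uIter φ ψ u (k + 1) (f * L.Dx g) =
      L.alpha * L.uIter φ ψ u k
        (g * L.pearsonOp (L.phiIter φ ψ k) (L.psiIter φ ψ k) f) := by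
  have e := congrArg (L.uIter φ ψ u k)
    (L.mul_Dx_mul_Dx_add (L.phiIter φ ψ k) (L.psiIter φ ψ k) f g)
  rw [L.uIter_pearsonOp h, map_add, ← smul_eq_C_mul, map_smul, smul_eq_mul] at e
  rw [uIter_succ_apply]
  linear_combination -e

/-- The polynomial `L_k L_{k+1} ⋯ L_{k+m-1} 1`, where `L_j` is the operator
`f ↦ φ^{[j]} D_x f + ψ^{[j]} S_x f`. For `k = 0` it is, up to a factor, the orthogonal polynomial of
degree `m`. -/
noncomputable def rodriguesPoly (L : QLattice) (φ ψ : ℂ[X]) : ℕ → ℕ → ℂ[X]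
  | _, 0 => 1
  | k, m + 1 => L.pearsonOp (L.phiIter φ ψ k) (L.psiIter φ ψ k) (rodriguesPoly L φ ψ (k + 1) m)

/-- The Rodrigues formula before normalization: `D_x^m u^{[k+m]} = (-α)^m (L_k ⋯ L_{k+m-1} 1)
u^{[k]}` with the operators `L_j` of the pairs `(φ^{[j]}, ψ^{[j]})`. -/
theorem iterate_DxF_uIter (L : QLattice) {φ ψ : ℂ[X]} {u : Module.Dual ℂ ℂ[X]}
    (h : ∀ f, u (L.pearsonOp φ ψ f) = 0) (m k : ℕ) :
    (L.DxF)^[m] (L.uIter φ ψ u (k + m)) =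
      (-L.alpha) ^ m • mulF (L.rodriguesPoly φ ψ k m) (L.uIter φ ψ u k) := by
  induction m generalizing k with
  | zero =>
    ext
    simp [rodriguesPoly, mulF]
  | succ m ih =>
    rw [Function.iterate_succ_apply', show k + (m + 1) = k + 1 + m by ring, ih]
    refine LinearMap.ext fun g => ?_
    simp only [DxF, mulF, LinearMap.neg_apply, LinearMap.comp_apply, LinearMap.smul_apply,
      LinearMap.mulLeft_apply, smul_eq_mul, L.uIter_succ_mul_Dx h, rodriguesPoly]
    rw [mul_comm g]
    ring

theorem iterate_DxF_apply (L : QLattice) (v : Module.Dual ℂ ℂ[X]) (m : ℕ) (f : ℂ[X]) :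
    (L.DxF)^[m] v f = (-1) ^ m * v ((L.Dx)^[m] f) := by
  induction m generalizing f with
  | zero => simp
  | succ m ih =>
    rw [Function.iterate_succ_apply', DxF, LinearMap.neg_apply, LinearMap.comp_apply, ih,
      Function.iterate_succ_apply]
    ring

/-- The source of orthogonality: the right-hand side vanishes for polynomials `f` of degree less
than `n`. -/
theorem apply_rodriguesPoly_mul (L : QLattice) {φ ψ : ℂ[X]} {u : Module.Dual ℂ ℂ[X]}
    (h : ∀ f, u (L.pearsonOp φ ψ f) = 0) (n : ℕ) (f : ℂ[X]) :
    L.alpha ^ n * u (L.rodriguesPoly φ ψ 0 n * f) = L.uIter φ ψ u n ((L.Dx)^[n] f) := by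
  have e := LinearMap.congr_fun (L.iterate_DxF_uIter h n 0) f
  rw [iterate_DxF_apply, zero_add] at e
  simp only [mulF, LinearMap.smul_apply, LinearMap.comp_apply, LinearMap.mulLeft_apply,
    smul_eq_mul, uIter, neg_pow L.alpha] at e
  exact (mul_left_cancel₀ (pow_ne_zero n (neg_ne_zero.2 one_ne_zero))
    (by rw [e]; ring)).symm

/-! ### Closed forms of the iterated polynomials -/

theorem eq_of_natDegree_le_two (c : ℂ) {φ : ℂ[X]} (h : φ.natDegree ≤ 2) :
    φ = C (φ.coeff 2) * (X - C c) ^ 2 + C ((derivative φ).eval c) * (X - C c) + C (φ.eval c) := by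
  have e : φ = C (φ.coeff 2) * X ^ 2 + C (φ.coeff 1) * X + C (φ.coeff 0) := by
    conv_lhs => rw [φ.as_sum_range_C_mul_X_pow' (Nat.lt_succ_of_le h)]
    simp [Finset.sum_range_succ]
    ring
  generalize φ.coeff 2 = a at *
  generalize φ.coeff 1 = b at *
  generalize φ.coeff 0 = d at *
  subst e
  simp
  ring

theorem eq_of_natDegree_le_one (c : ℂ) {ψ : ℂ[X]} (h : ψ.natDegree ≤ 1) :
    ψ = C (ψ.coeff 1) * (X - C c) + C (ψ.eval c) := by
  have e : ψ = C (ψ.coeff 1) * X + C (ψ.coeff 0) := by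
    conv_lhs => rw [ψ.as_sum_range_C_mul_X_pow' (Nat.lt_succ_of_le h)]
    simp [Finset.sum_range_succ]
    ring
  generalize ψ.coeff 1 = b at *
  generalize ψ.coeff 0 = d at *
  subst e
  simp
  ring

theorem phiIter_psiIter_eq_explicit (L : QLattice) {φ ψ : ℂ[X]} (hφ : φ.natDegree ≤ 2)
    (hψ : ψ.natDegree ≤ 1) (k : ℕ) :
    L.phiIter φ ψ k = L.phiExplicit φ ψ k ∧ L.psiIter φ ψ k = L.psiExplicit φ ψ k := by
  induction k with
  | zero =>
    constructor
    · rw [phiIter, pairIter, phiExplicit]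
      conv_lhs => rw [eq_of_natDegree_le_two L.c₃ hφ]
      simp only [Nat.cast_zero, mul_zero, alphaSeq_zero, gammaSeq_zero, map_add, map_mul, map_zero,
        map_ofNat, map_one]
      ring
    · rw [psiIter, pairIter, psiExplicit]
      conv_lhs => rw [eq_of_natDegree_le_one L.c₃ hψ]
      simp only [Nat.cast_zero, mul_zero, alphaSeq_zero, gammaSeq_zero, zero_add, mul_one]
  | succ k ih =>
    have a1 := L.alphaSeq_add k 1
    have g1 := L.gammaSeq_add k 1
    have a2 := L.alphaSeq_add (2 * k) (1 + 1)
    have g2 := L.gammaSeq_add (2 * k) (1 + 1)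
    rw [L.alphaSeq_add 1 1, L.gammaSeq_add 1 1] at a2 g2
    rw [alphaSeq_one, gammaSeq_one] at a1 g1 a2 g2
    have e : (2 : ℤ) * ((k + 1 : ℕ) : ℤ) = 2 * k + (1 + 1) := by push_cast; ring
    rw [phiIter_succ, psiIter_succ, ih.1, ih.2]
    simp only [phiExplicit, psiExplicit, e, a2, g2]
    simp only [Nat.cast_succ, a1, g1]
    rw [show (X - C L.c₃ : ℂ[X]) = L.Y from rfl]
    simp only [Dx_mul, Sx_mul, map_sub, map_add, Dx_C, Sx_C, Dx_Y, Sx_Y, U₁_eq, U₂_eq, sq]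
    simp only [map_sub, map_add, map_mul, map_ofNat, map_one]
    constructor <;> ring

theorem coeff_phiExplicit (L : QLattice) (φ ψ : ℂ[X]) (k : ℕ) :
    (L.phiExplicit φ ψ k).natDegree ≤ 2 ∧ (L.phiExplicit φ ψ k).coeff 2 =
      ψ.coeff 1 * (L.alpha ^ 2 - 1) * L.gammaSeq (2 * k) + φ.coeff 2 * L.alphaSeq (2 * k) ∧
    (derivative (L.phiExplicit φ ψ k)).eval L.c₃ =
      (derivative φ).eval L.c₃ * L.alphaSeq k +
        ψ.eval L.c₃ * (L.alpha ^ 2 - 1) * L.gammaSeq k := by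
  rw [phiExplicit]
  generalize ψ.coeff 1 * (L.alpha ^ 2 - 1) * L.gammaSeq (2 * k) +
    φ.coeff 2 * L.alphaSeq (2 * k) = A
  generalize (derivative φ).eval L.c₃ * L.alphaSeq k +
        ψ.eval L.c₃ * (L.alpha ^ 2 - 1) * L.gammaSeq k = B
  refine ⟨by compute_degree, ?_, by simp [sq]⟩
  have e (r s : ℂ) : C A * ((X - C L.c₃) ^ 2 - C r) + C B * (X - C L.c₃) + C s =
      C A * X ^ 2 + C (B - 2 * A * L.c₃) * X + C (A * L.c₃ ^ 2 - A * r - B * L.c₃ + s) := by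
    simp only [map_add, map_sub, map_mul, map_pow, map_ofNat]
    ring
  rw [e]
  simp only [coeff_add, coeff_C_mul, coeff_X_pow, coeff_C, coeff_X]
  norm_num

theorem coeff_psiExplicit (L : QLattice) (φ ψ : ℂ[X]) (k : ℕ) :
    (L.psiExplicit φ ψ k).natDegree ≤ 1 ∧ (L.psiExplicit φ ψ k).coeff 1 =
      φ.coeff 2 * L.gammaSeq (2 * k) + ψ.coeff 1 * L.alphaSeq (2 * k) ∧
    (L.psiExplicit φ ψ k).eval L.c₃ =
      (derivative φ).eval L.c₃ * L.gammaSeq k + ψ.eval L.c₃ * L.alphaSeq k := by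
  rw [psiExplicit]
  refine ⟨by compute_degree, ?_, by simp⟩
  rw [mul_sub, coeff_add, coeff_sub, coeff_C_mul_X, ← C_mul, coeff_C, coeff_C]
  simp

theorem natDegree_phiIter_le (L : QLattice) {φ ψ : ℂ[X]} (hφ : φ.natDegree ≤ 2)
    (hψ : ψ.natDegree ≤ 1) (k : ℕ) : (L.phiIter φ ψ k).natDegree ≤ 2 := by
  rw [(L.phiIter_psiIter_eq_explicit hφ hψ k).1]
  exact (L.coeff_phiExplicit φ ψ k).1

theorem natDegree_psiIter_le (L : QLattice) {φ ψ : ℂ[X]} (hφ : φ.natDegree ≤ 2)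
    (hψ : ψ.natDegree ≤ 1) (k : ℕ) : (L.psiIter φ ψ k).natDegree ≤ 1 := by
  rw [(L.phiIter_psiIter_eq_explicit hφ hψ k).2]
  exact (L.coeff_psiExplicit φ ψ k).1

/-- Passing to `(φ^{[k]}, ψ^{[k]})` shifts the index of `d` by `2 k`. -/
theorem d_iter (L : QLattice) {φ ψ : ℂ[X]} (hφ : φ.natDegree ≤ 2) (hψ : ψ.natDegree ≤ 1)
    (k : ℕ) (n : ℤ) :
    L.d (L.phiIter φ ψ k) (L.psiIter φ ψ k) n = L.d φ ψ (n + 2 * k) := by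
  obtain ⟨h1, h2⟩ := L.phiIter_psiIter_eq_explicit hφ hψ k
  rw [d, d, h1, h2, (L.coeff_phiExplicit φ ψ k).2.1, (L.coeff_psiExplicit φ ψ k).2.1,
    alphaSeq_add, gammaSeq_add]
  ring

/-- Passing to `(φ^{[k]}, ψ^{[k]})` shifts the index of `e` by `k`. -/
theorem e_iter (L : QLattice) {φ ψ : ℂ[X]} (hφ : φ.natDegree ≤ 2) (hψ : ψ.natDegree ≤ 1)
    (k : ℕ) (n : ℤ) :
    L.e (L.phiIter φ ψ k) (L.psiIter φ ψ k) n = L.e φ ψ (n + k) := by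
  obtain ⟨h1, h2⟩ := L.phiIter_psiIter_eq_explicit hφ hψ k
  rw [e, e, h1, h2, (L.coeff_phiExplicit φ ψ k).2.2, (L.coeff_psiExplicit φ ψ k).2.2,
    alphaSeq_add, gammaSeq_add]
  ring

theorem psiIter_eq (L : QLattice) {φ ψ : ℂ[X]} (hφ : φ.natDegree ≤ 2) (hψ : ψ.natDegree ≤ 1)
    (k : ℕ) : L.psiIter φ ψ k = C (L.d φ ψ (2 * k)) * (X - C L.c₃) + C (L.e φ ψ k) :=
  (L.phiIter_psiIter_eq_explicit hφ hψ k).2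


/-! ### Degrees and leading terms -/

theorem mul_mem_degreeLT {p r : ℂ[X]} {i n : ℕ} (hp : p.natDegree ≤ i)
    (hr : r ∈ degreeLT ℂ n) : p * r ∈ degreeLT ℂ (n + i) := by
  rw [mem_degreeLT] at *
  rcases eq_or_ne r 0 with rfl | h0
  · simp
  rw [degree_eq_natDegree h0] at hr
  have hr' : r.natDegree < n := by exact_mod_cast hr
  have : (p * r).natDegree < n + i := by
    have := natDegree_mul_le (p := p) (q := r)
    omega
  exact (degree_le_natDegree).trans_lt (by exact_mod_cast this)

theorem eq_zero_of_mem_degreeLT_zero {r : ℂ[X]} (h : r ∈ degreeLT ℂ 0) : r = 0 := by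
  rwa [mem_degreeLT, Nat.cast_zero, Nat.WithBot.lt_zero_iff, degree_eq_bot] at h

theorem C_mul_mem_degreeLT (a : ℂ) {r : ℂ[X]} {n : ℕ} (hr : r ∈ degreeLT ℂ n) :
    C a * r ∈ degreeLT ℂ n := by
  rw [← smul_eq_C_mul]
  exact Submodule.smul_mem _ _ hr

theorem monic_Y (L : QLattice) : L.Y.Monic := monic_X_sub_C _

theorem natDegree_Y (L : QLattice) : L.Y.natDegree = 1 := natDegree_X_sub_C _

theorem natDegree_Y_pow (L : QLattice) (n : ℕ) : (L.Y ^ n).natDegree = n := by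
  rw [L.monic_Y.natDegree_pow, natDegree_Y, mul_one]

theorem Y_pow_mem (L : QLattice) {m n : ℕ} (h : m < n) : L.Y ^ m ∈ degreeLT ℂ n := by
  rw [mem_degreeLT, degree_eq_natDegree (L.monic_Y.pow m).ne_zero, natDegree_Y_pow]
  exact_mod_cast h

theorem coeff_Y_pow (L : QLattice) (n : ℕ) : (L.Y ^ n).coeff n = 1 := by
  have := (L.monic_Y.pow n).coeff_natDegree
  rwa [natDegree_Y_pow] at this

theorem Y_mul_mem (L : QLattice) {r : ℂ[X]} {n : ℕ} (h : r ∈ degreeLT ℂ n) :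
    L.Y * r ∈ degreeLT ℂ (n + 1) :=
  mul_mem_degreeLT L.natDegree_Y.le h

theorem mem_of_Y_mul_mem (L : QLattice) {r : ℂ[X]} {n : ℕ} (h : L.Y * r ∈ degreeLT ℂ n) :
    r ∈ degreeLT ℂ n := by
  rw [mem_degreeLT] at *
  exact (degree_le_mul_left _ L.monic_Y.ne_zero |>.trans_eq (by rw [mul_comm])).trans_lt h

theorem mem_degreeLT_succ {r : ℂ[X]} {n : ℕ} (h : r ∈ degreeLT ℂ n) : r ∈ degreeLT ℂ (n + 1) :=
  degreeLT_mono n.le_succ h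

/-- Splitting off the leading term in powers of the lattice coordinate; the basis of the
inductions on the degree. -/
theorem sub_coeff_mul_Y_pow_mem (L : QLattice) {f : ℂ[X]} {n : ℕ}
    (h : f ∈ degreeLT ℂ (n + 1)) : f - C (f.coeff n) * L.Y ^ n ∈ degreeLT ℂ n := by
  rw [mem_degreeLT, degree_lt_iff_coeff_zero] at *
  intro m hm
  rcases hm.eq_or_lt with rfl | hm
  · rw [coeff_sub, coeff_C_mul, coeff_Y_pow, mul_one, sub_self]
  · rw [coeff_sub, coeff_C_mul, h m hm, coeff_eq_zero_of_natDegree_lt (p := L.Y ^ n)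
      (by rwa [natDegree_Y_pow]), mul_zero, sub_zero]

theorem coeff_eq_zero_of_mem {r : ℂ[X]} {n : ℕ} (h : r ∈ degreeLT ℂ n) : r.coeff n = 0 := by
  rw [mem_degreeLT, degree_lt_iff_coeff_zero] at h
  exact h n le_rfl

/-- By parity, `D_x` and `S_x` map a power of `z - c₃` to a multiple of a power, up to terms whose
degree is lower by at least two. The factor `Y` in the first statement avoids the exponent
`m - 1`. -/
theorem Dx_Sx_Y_pow (L : QLattice) (m : ℕ) :
    L.Y * (L.Dx (L.Y ^ (m + 1)) - C (L.gammaSeq (m + 1)) * L.Y ^ m) ∈ degreeLT ℂ m ∧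
      L.Sx (L.Y ^ (m + 1)) - C (L.alphaSeq (m + 1)) * L.Y ^ (m + 1) ∈ degreeLT ℂ m := by
  induction m with
  | zero =>
    simp [Dx_Y, Sx_Y, gammaSeq_one, alphaSeq_one]
  | succ m ih =>
    obtain ⟨hD, hS⟩ := ih
    have a1 := L.alphaSeq_add (m + 1) 1
    have g1 := L.gammaSeq_add (m + 1) 1
    rw [alphaSeq_one, gammaSeq_one] at a1 g1
    rw [pow_succ' L.Y (m + 1), Dx_mul, Sx_mul, Dx_Y, Sx_Y]
    push_cast
    rw [a1, g1]
    generalize L.gammaSeq (m + 1) = γ at *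
    generalize L.alphaSeq (m + 1) = α at *
    obtain ⟨r, hr⟩ : ∃ r, L.Dx (L.Y ^ (m + 1)) - C γ * L.Y ^ m = r := ⟨_, rfl⟩
    obtain ⟨t, ht⟩ : ∃ t, L.Sx (L.Y ^ (m + 1)) - C α * L.Y ^ (m + 1) = t := ⟨_, rfl⟩
    rw [hr] at hD
    rw [ht] at hS
    rw [sub_eq_iff_eq_add] at hr ht
    have hr' := L.mem_of_Y_mul_mem hD
    constructor
    · convert L.Y_mul_mem (add_mem hS (C_mul_mem_degreeLT L.alpha hD)) using 1
      rw [hr, ht]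
      simp only [map_add, map_mul, map_one]
      ring
    · convert add_mem (add_mem (C_mul_mem_degreeLT (L.alpha ^ 2 - 1) (L.Y_mul_mem hD))
        (C_mul_mem_degreeLT L.alpha (L.Y_mul_mem hS)))
        (C_mul_mem_degreeLT (-(L.alpha ^ 2 - 1) * (4 * L.c₁ * L.c₂))
          (add_mem (mem_degreeLT_succ hr') (C_mul_mem_degreeLT γ (L.Y_pow_mem m.lt_succ_self))))
        using 1
      rw [hr, ht, U₂_eq]
      simp only [map_add, map_mul, map_one, map_neg, map_sub, map_pow, map_ofNat]
      ring

theorem Dx_mem (L : QLattice) {f : ℂ[X]} {n : ℕ} (h : f ∈ degreeLT ℂ (n + 1)) :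
    L.Dx f ∈ degreeLT ℂ n := by
  induction n generalizing f with
  | zero =>
    have := sub_eq_zero.1 (eq_zero_of_mem_degreeLT_zero (L.sub_coeff_mul_Y_pow_mem h))
    rw [this, pow_zero, mul_one, Dx_C]
    exact zero_mem _
  | succ n ih =>
    have h1 := mem_degreeLT_succ (ih (L.sub_coeff_mul_Y_pow_mem h))
    have h2 := mem_degreeLT_succ (L.mem_of_Y_mul_mem (L.Dx_Sx_Y_pow n).1)
    have h3 := add_mem h2 (C_mul_mem_degreeLT (L.gammaSeq (n + 1)) (L.Y_pow_mem n.lt_succ_self))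
    rw [sub_add_cancel] at h3
    have := add_mem h1 (C_mul_mem_degreeLT (f.coeff (n + 1)) h3)
    rwa [← Dx_C_mul, ← map_add, sub_add_cancel] at this

theorem Sx_Y_pow_mem (L : QLattice) (n : ℕ) :
    L.Sx (L.Y ^ n) - C (L.alphaSeq n) * L.Y ^ n ∈ degreeLT ℂ n := by
  cases n with
  | zero => simp [Sx_one, alphaSeq_zero]
  | succ n => exact_mod_cast mem_degreeLT_succ (L.Dx_Sx_Y_pow n).2

theorem Sx_mem (L : QLattice) {f : ℂ[X]} {n : ℕ} (h : f ∈ degreeLT ℂ n) :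
    L.Sx f ∈ degreeLT ℂ n := by
  induction n generalizing f with
  | zero =>
    simp [eq_zero_of_mem_degreeLT_zero h]
  | succ n ih =>
    have h1 := mem_degreeLT_succ (ih (L.sub_coeff_mul_Y_pow_mem h))
    have h3 := add_mem (mem_degreeLT_succ (L.Sx_Y_pow_mem n))
      (C_mul_mem_degreeLT (L.alphaSeq n) (L.Y_pow_mem n.lt_succ_self))
    rw [sub_add_cancel] at h3
    have := add_mem h1 (C_mul_mem_degreeLT (f.coeff n) h3)
    rwa [← Sx_C_mul, ← map_add, sub_add_cancel] at this

theorem coeff_Dx (L : QLattice) {f : ℂ[X]} {n : ℕ} (h : f ∈ degreeLT ℂ (n + 2)) :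
    (L.Dx f).coeff n = L.gammaSeq (n + 1) * f.coeff (n + 1) := by
  have h1 := coeff_eq_zero_of_mem (L.Dx_mem (L.sub_coeff_mul_Y_pow_mem h))
  have h2 := coeff_eq_zero_of_mem (L.mem_of_Y_mul_mem (L.Dx_Sx_Y_pow n).1)
  rw [map_sub, Dx_C_mul, coeff_sub, coeff_C_mul] at h1
  rw [coeff_sub, coeff_C_mul, coeff_Y_pow] at h2
  linear_combination h1 + f.coeff (n + 1) * h2

theorem coeff_Sx (L : QLattice) {f : ℂ[X]} {n : ℕ} (h : f ∈ degreeLT ℂ (n + 1)) :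
    (L.Sx f).coeff n = L.alphaSeq n * f.coeff n := by
  have h1 := coeff_eq_zero_of_mem (L.Sx_mem (L.sub_coeff_mul_Y_pow_mem h))
  have h2 := coeff_eq_zero_of_mem (L.Sx_Y_pow_mem n)
  rw [map_sub, Sx_C_mul, coeff_sub, coeff_C_mul] at h1
  rw [coeff_sub, coeff_C_mul, coeff_Y_pow] at h2
  linear_combination h1 + f.coeff n * h2

theorem iterate_Dx_eq_zero (L : QLattice) {f : ℂ[X]} {n : ℕ} (h : f ∈ degreeLT ℂ n) :
    (L.Dx)^[n] f = 0 := by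
  induction n generalizing f with
  | zero => exact eq_zero_of_mem_degreeLT_zero h
  | succ n ih => exact ih (L.Dx_mem h)

theorem iterate_Dx_eq_C (L : QLattice) {f : ℂ[X]} {n : ℕ} (h : f ∈ degreeLT ℂ (n + 1)) :
    (L.Dx)^[n] f = C (f.coeff n * ∏ i ∈ Finset.range n, L.gammaSeq (i + 1)) := by
  induction n generalizing f with
  | zero =>
    simpa using sub_eq_zero.1 (eq_zero_of_mem_degreeLT_zero (L.sub_coeff_mul_Y_pow_mem h))
  | succ n ih =>
    rw [Function.iterate_succ_apply, ih (L.Dx_mem h), L.coeff_Dx h, Finset.prod_range_succ]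
    congr 1
    ring

variable {φ ψ : ℂ[X]}

theorem pearsonOp_C_mul (L : QLattice) (φ ψ : ℂ[X]) (a : ℂ) (f : ℂ[X]) :
    L.pearsonOp φ ψ (C a * f) = C a * L.pearsonOp φ ψ f := by
  rw [← smul_eq_C_mul, map_smul, smul_eq_C_mul]

theorem pearsonOp_mem (L : QLattice) (hφ : φ.natDegree ≤ 2) (hψ : ψ.natDegree ≤ 1) {f : ℂ[X]}
    {n : ℕ} (h : f ∈ degreeLT ℂ n) : L.pearsonOp φ ψ f ∈ degreeLT ℂ (n + 1) := by
  rw [pearsonOp_apply]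
  refine add_mem ?_ (mul_mem_degreeLT hψ (L.Sx_mem h))
  cases n with
  | zero =>
    simp [eq_zero_of_mem_degreeLT_zero h]
  | succ n => exact (mul_mem_degreeLT hφ (L.Dx_mem h) : _ ∈ degreeLT ℂ (n + 2))

/-- The two highest terms of `φ D_x f + ψ S_x f` for a power `f` of `z - c₃`. -/
theorem pearsonOp_Y_pow (L : QLattice) (hφ : φ.natDegree ≤ 2) (hψ : ψ.natDegree ≤ 1) (m : ℕ) :
    L.pearsonOp φ ψ (L.Y ^ m) -
      (C (L.d φ ψ m) * L.Y ^ (m + 1) + C (L.e φ ψ m) * L.Y ^ m) ∈ degreeLT ℂ m := by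
  have e1 := eq_of_natDegree_le_two L.c₃ hφ
  have e2 := eq_of_natDegree_le_one L.c₃ hψ
  rw [show (X - C L.c₃ : ℂ[X]) = L.Y from rfl] at e1 e2
  rw [pearsonOp_apply, d, e]
  generalize φ.coeff 2 = a at *
  generalize (derivative φ).eval L.c₃ = b at *
  generalize φ.eval L.c₃ = c at *
  generalize ψ.coeff 1 = d at *
  generalize ψ.eval L.c₃ = e at *
  rw [e1, e2]
  cases m with
  | zero =>
    simp [Dx_one, Sx_one, gammaSeq_zero, alphaSeq_zero]
  | succ m =>
    obtain ⟨hD, hS⟩ := L.Dx_Sx_Y_pow m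
    push_cast
    generalize L.gammaSeq (m + 1) = γ at *
    generalize L.alphaSeq (m + 1) = α at *
    obtain ⟨r, hr⟩ : ∃ r, L.Dx (L.Y ^ (m + 1)) - C γ * L.Y ^ m = r := ⟨_, rfl⟩
    obtain ⟨t, ht⟩ : ∃ t, L.Sx (L.Y ^ (m + 1)) - C α * L.Y ^ (m + 1) = t := ⟨_, rfl⟩
    rw [hr] at hD
    rw [ht] at hS
    rw [sub_eq_iff_eq_add] at hr ht
    have hr' := L.mem_of_Y_mul_mem hD
    convert add_mem (add_mem (add_mem (C_mul_mem_degreeLT a (L.Y_mul_mem hD))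
      (C_mul_mem_degreeLT b (mem_degreeLT_succ hD))) (C_mul_mem_degreeLT c
        (add_mem (mem_degreeLT_succ hr') (C_mul_mem_degreeLT γ (L.Y_pow_mem m.lt_succ_self)))))
      (add_mem (C_mul_mem_degreeLT d (L.Y_mul_mem hS))
        (C_mul_mem_degreeLT e (mem_degreeLT_succ hS))) using 1
    rw [hr, ht]
    simp only [map_add, map_mul]
    ring

theorem coeff_pearsonOp (L : QLattice) (hφ : φ.natDegree ≤ 2) (hψ : ψ.natDegree ≤ 1) {f : ℂ[X]}
    {n : ℕ} (h : f ∈ degreeLT ℂ (n + 1)) :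
    (L.pearsonOp φ ψ f).coeff (n + 1) = L.d φ ψ n * f.coeff n := by
  have h1 := coeff_eq_zero_of_mem (L.pearsonOp_mem hφ hψ (L.sub_coeff_mul_Y_pow_mem h))
  have h2 := coeff_eq_zero_of_mem (mem_degreeLT_succ (L.pearsonOp_Y_pow hφ hψ n))
  rw [map_sub, pearsonOp_C_mul, coeff_sub, coeff_C_mul] at h1
  rw [coeff_sub, coeff_add, coeff_C_mul, coeff_C_mul, coeff_Y_pow,
    coeff_eq_zero_of_mem (L.Y_pow_mem n.lt_succ_self)] at h2
  linear_combination h1 + f.coeff n * h2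

/-- The recursion behind the closed form of the subleading coefficients. -/
theorem d_add (L : QLattice) (φ ψ : ℂ[X]) (n m : ℤ) :
    L.d φ ψ (n + m) + L.gammaSeq m * L.d φ ψ (n - 1) = L.gammaSeq (m + 1) * L.d φ ψ n := by
  rw [d, d, d, sub_eq_add_neg, alphaSeq_add L n m, gammaSeq_add L n m, alphaSeq_add L n (-1),
    gammaSeq_add L n (-1), gammaSeq_add L m 1, alphaSeq_neg, gammaSeq_neg, gammaSeq_one,
    alphaSeq_one]
  have h1 := L.alphaSeq_sq m
  ring

/-- The coefficient of degree `m` of `rodriguesPoly k m`, namely `∏_{j<m} d_{2k+m-1+j}`. -/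
noncomputable def rodriguesLead (L : QLattice) (φ ψ : ℂ[X]) (k m : ℕ) : ℂ :=
  ∏ j ∈ Finset.range m, L.d φ ψ (2 * k + m - 1 + j)

theorem rodriguesLead_succ (L : QLattice) (φ ψ : ℂ[X]) (k m : ℕ) :
    L.rodriguesLead φ ψ k (m + 1) =
      L.d φ ψ (m + 2 * k) * L.rodriguesLead φ ψ (k + 1) m := by
  rw [rodriguesLead, rodriguesLead, Finset.prod_range_succ', mul_comm]
  congr 1
  · congr 1
    push_cast
    ring
  · refine Finset.prod_congr rfl fun j _ => ?_
    congr 1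
    push_cast
    ring

/-- The two highest terms of `rodriguesPoly` in powers of `z - c₃`. -/
theorem rodriguesPoly_sub_mem (L : QLattice) (hφ : φ.natDegree ≤ 2) (hψ : ψ.natDegree ≤ 1)
    (hd : L.IsAdmissible φ ψ) (k m : ℕ) :
    L.rodriguesPoly φ ψ k (m + 1) - C (L.rodriguesLead φ ψ k (m + 1)) *
      (L.Y ^ (m + 1) + C (L.gammaSeq (m + 1) * L.e φ ψ (k + m) / L.d φ ψ (2 * k + 2 * m)) *
        L.Y ^ m) ∈ degreeLT ℂ m := by
  induction m generalizing k with
  | zero =>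
    have h0 : L.d φ ψ (2 * k) ≠ 0 := by exact_mod_cast hd (2 * k)
    rw [rodriguesPoly, rodriguesPoly, pearsonOp_apply, Dx_one, Sx_one, L.psiIter_eq hφ hψ,
      rodriguesLead_succ]
    simp only [rodriguesLead, Finset.prod_range_zero, Nat.cast_zero, zero_add, mul_zero, mul_one,
      add_zero, pow_one, pow_zero, gammaSeq_one, one_mul]
    rw [mul_add, ← C_mul, mul_div_cancel₀ _ h0, ← Y, sub_self]
    exact zero_mem _
  | succ m ih =>
    have h0 : L.d φ ψ (2 * k + 2 * (m + 1)) ≠ 0 := by exact_mod_cast hd (2 * k + 2 * (m + 1))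
    have h := ih (k + 1)
    rw [rodriguesPoly, rodriguesLead_succ]
    obtain ⟨r, hr⟩ : ∃ r, r = L.rodriguesPoly φ ψ (k + 1) (m + 1) -
      C (L.rodriguesLead φ ψ (k + 1) (m + 1)) * (L.Y ^ (m + 1) + C (L.gammaSeq (m + 1) *
        L.e φ ψ ((k + 1 : ℕ) + m) / L.d φ ψ (2 * (k + 1 : ℕ) + 2 * m)) * L.Y ^ m) := ⟨_, rfl⟩
    rw [← hr] at h
    rw [eq_sub_iff_add_eq'] at hr
    have hφ' := L.natDegree_phiIter_le hφ hψ k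
    have hψ' := L.natDegree_psiIter_le hφ hψ k
    have p1 := L.pearsonOp_Y_pow hφ' hψ' (m + 1)
    have p2 := mem_degreeLT_succ (L.pearsonOp_Y_pow hφ' hψ' m)
    have p3 := L.pearsonOp_mem hφ' hψ' h
    rw [d_iter L hφ hψ, e_iter L hφ hψ] at p1 p2
    have key := L.d_add φ ψ ((m + 1 : ℕ) + 2 * k) (m + 1)
    rw [show ((m + 1 : ℕ) + 2 * k + (m + 1) : ℤ) = 2 * k + 2 * (m + 1) by push_cast; ring,
      show ((m + 1 : ℕ) + 2 * k - 1 : ℤ) = m + 2 * k by push_cast; ring] at key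
    rw [← hr, show (((m + 1 : ℕ) : ℤ) + k) = k + (m + 1 : ℕ) by ring] at *
    rw [show ((k + 1 : ℕ) + m : ℤ) = k + (m + 1 : ℕ) by push_cast; ring,
      show (2 * (k + 1 : ℕ) + 2 * m : ℤ) = 2 * k + 2 * (m + 1) by push_cast; ring]
    have e2 : (2 * k + 2 * (m + 1 : ℕ) : ℤ) = 2 * k + 2 * (m + 1) := by push_cast; ring
    have e3 : (((m + 1 : ℕ) : ℤ) + 1) = m + 1 + 1 := by push_cast; ring
    rw [e2, e3]
    generalize L.rodriguesLead φ ψ (k + 1) (m + 1) = l at *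
    generalize L.e φ ψ (k + (m + 1 : ℕ)) = e at *
    generalize L.d φ ψ (2 * k + 2 * (m + 1)) = D at *
    generalize L.d φ ψ ((m + 1 : ℕ) + 2 * k) = d₁ at *
    generalize L.d φ ψ (m + 2 * k) = d₀ at *
    -- the recursion for the quotient of the two highest coefficients, an instance of `d_add`
    have key' : d₁ * (L.gammaSeq (m + 1 + 1) * e / D) = e + L.gammaSeq (m + 1) * e / D * d₀ := by
      field_simp
      linear_combination -e * key
    generalize L.gammaSeq (m + 1 + 1) * e / D = f₁ at *
    generalize L.gammaSeq (m + 1) * e / D = f₀ at *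
    convert add_mem (add_mem (C_mul_mem_degreeLT l p1) (C_mul_mem_degreeLT (l * f₀)
      (add_mem p2 (C_mul_mem_degreeLT (L.e φ ψ (m + k)) (L.Y_pow_mem m.lt_succ_self))))) p3 using 1
    have key'' := congrArg C key'
    simp only [map_add, map_mul, pearsonOp_C_mul, mul_add, mul_assoc] at key'' ⊢
    linear_combination -C l * L.Y ^ (m + 1) * key''

/-! ### Orthogonal polynomial sequences -/

theorem sub_C_div_mul_mem {f g : ℂ[X]} {n : ℕ} (hf : f ∈ degreeLT ℂ (n + 1))
    (hg : g ∈ degreeLT ℂ (n + 1)) (h : g.coeff n ≠ 0) :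
    f - C (f.coeff n / g.coeff n) * g ∈ degreeLT ℂ n := by
  rw [mem_degreeLT, degree_lt_iff_coeff_zero] at *
  intro m hm
  rcases hm.eq_or_lt with rfl | hm
  · rw [coeff_sub, coeff_C_mul, div_mul_cancel₀ _ h, sub_self]
  · rw [coeff_sub, coeff_C_mul, hf m hm, hg m hm, mul_zero, sub_zero]

theorem mem_degreeLT_natDegree_succ (f : ℂ[X]) : f ∈ degreeLT ℂ (f.natDegree + 1) := by
  rw [mem_degreeLT]
  exact degree_le_natDegree.trans_lt (by exact_mod_cast f.natDegree.lt_succ_self)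

variable {u : Module.Dual ℂ ℂ[X]} {P : ℕ → ℂ[X]}

theorem IsOPS.mem (hP : IsOPS u P) (n : ℕ) : P n ∈ degreeLT ℂ (n + 1) := by
  rw [mem_degreeLT, hP.1]
  exact_mod_cast n.lt_succ_self

theorem IsOPS.coeff_ne_zero (hP : IsOPS u P) (n : ℕ) : (P n).coeff n ≠ 0 :=
  coeff_ne_zero_of_eq_degree (hP.1 n)

theorem IsOPS.apply_mul_eq_zero (hP : IsOPS u P) {n : ℕ} {f : ℂ[X]} (hf : f ∈ degreeLT ℂ n) :
    u (P n * f) = 0 := by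
  have key (m : ℕ) : ∀ f, m ≤ n → f ∈ degreeLT ℂ m → u (P n * f) = 0 := by
    induction m with
    | zero =>
      intro f _ hf
      rw [eq_zero_of_mem_degreeLT_zero hf, mul_zero, map_zero]
    | succ m ih =>
      intro f hm hf
      have h := ih _ (by omega) (sub_C_div_mul_mem hf (hP.mem m) (hP.coeff_ne_zero m))
      obtain ⟨h', -, ho⟩ := hP.2
      rw [mul_sub, map_sub, mul_left_comm, ← smul_eq_C_mul, map_smul, ho, if_neg (by omega),
        smul_zero, sub_zero] at h
      exact h
  exact key n f le_rfl hf

theorem IsOPS.apply_mul_ne_zero (hP : IsOPS u P) {n : ℕ} {f : ℂ[X]}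
    (hf : f ∈ degreeLT ℂ (n + 1)) (h0 : f.coeff n ≠ 0) : u (P n * f) ≠ 0 := by
  have h := hP.apply_mul_eq_zero (sub_C_div_mul_mem hf (hP.mem n) (hP.coeff_ne_zero n))
  obtain ⟨h', h'0, ho⟩ := hP.2
  rw [mul_sub, map_sub, mul_left_comm, ← smul_eq_C_mul, map_smul, ho, if_pos rfl, sub_eq_zero] at h
  rw [h, smul_eq_mul]
  exact mul_ne_zero (div_ne_zero h0 (hP.coeff_ne_zero n)) (h'0 n)

/-- A regular functional is nondegenerate on the polynomials of degree less than `n`. -/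
theorem IsOPS.eq_zero (hP : IsOPS u P) {n : ℕ} {f : ℂ[X]} (hf : f ∈ degreeLT ℂ n)
    (h : ∀ g ∈ degreeLT ℂ n, u (f * g) = 0) : f = 0 := by
  by_contra h0
  have hn : f.natDegree < n := by
    rw [mem_degreeLT, degree_eq_natDegree h0] at hf
    exact_mod_cast hf
  refine hP.apply_mul_ne_zero (mem_degreeLT_natDegree_succ f) ?_
    ((congrArg u (mul_comm _ _)).trans (h (P f.natDegree) (degreeLT_mono hn (hP.mem _))))
  exact leadingCoeff_ne_zero.2 h0

theorem IsMonicOPS.unique {Q : ℕ → ℂ[X]} (hP : IsMonicOPS u P) (hQ : IsMonicOPS u Q) : Q = P := by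
  funext n
  rw [← sub_eq_zero]
  have hn : Q n - P n ∈ degreeLT ℂ n := by
    rw [mem_degreeLT]
    refine (degree_sub_lt_left (by rw [hP.1.1, hQ.1.1]) (hQ.2 n).ne_zero ?_).trans_eq (hQ.1.1 n)
    rw [(hP.2 n).leadingCoeff, (hQ.2 n).leadingCoeff]
  refine hP.1.eq_zero hn fun g hg => ?_
  rw [sub_mul, map_sub, hP.1.apply_mul_eq_zero hg, hQ.1.apply_mul_eq_zero hg, sub_zero]

/-! ### Regularity implies admissibility -/

theorem exists_Dx_eq (L : QLattice) (g : ℂ[X]) : ∃ G, L.Dx G = g := by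
  have key (n : ℕ) : ∀ g ∈ degreeLT ℂ n, ∃ G, L.Dx G = g := by
    induction n with
    | zero =>
      intro g hg
      exact ⟨0, by rw [map_zero, eq_zero_of_mem_degreeLT_zero hg]⟩
    | succ n ih =>
      intro g hg
      have hY := L.Y_pow_mem (n + 1).lt_succ_self
      have hc : (L.Dx (L.Y ^ (n + 1))).coeff n ≠ 0 := by
        rw [L.coeff_Dx hY, coeff_Y_pow, mul_one]
        exact L.gammaSeq_ne_zero (by omega)
      obtain ⟨G, hG⟩ := ih _ (sub_C_div_mul_mem hg (L.Dx_mem hY) hc)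
      exact ⟨G + C (g.coeff n / (L.Dx (L.Y ^ (n + 1))).coeff n) * L.Y ^ (n + 1), by
        rw [map_add, Dx_C_mul, hG, sub_add_cancel]⟩
  exact key _ g (mem_degreeLT_natDegree_succ g)

/-- At `x(s)` this polynomial takes the value `w(x(s + 1/2)) w(x(s - 1/2))`. -/
theorem Sx_sq_sub_ne_zero (L : QLattice) {w : ℂ[X]} (hw : w ≠ 0) :
    L.Sx w ^ 2 - L.U₂ * L.Dx w ^ 2 ≠ 0 := by
  obtain ⟨n, hn⟩ : ∃ n, w.natDegree = n := ⟨_, rfl⟩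
  have hmem := mem_degreeLT_natDegree_succ w
  have hc := leadingCoeff_ne_zero.2 hw
  rw [leadingCoeff] at hc
  rw [hn] at hmem hc
  have nd {f : ℂ[X]} (h : f ∈ degreeLT ℂ (n + 1)) : f.natDegree ≤ n := by
    rw [mem_degreeLT] at h
    exact natDegree_le_iff_degree_le.2 (Order.lt_succ_iff.1 (by exact_mod_cast h))
  have hD := L.Dx_mem hmem
  have hYD := L.Y_mul_mem hD
  have cYD : (L.Y * L.Dx w).coeff n = L.gammaSeq n * w.coeff n := by
    cases n with
    | zero =>
      simp [eq_zero_of_mem_degreeLT_zero hD, gammaSeq_zero]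
    | succ n =>
      rw [Y, sub_mul, coeff_sub, coeff_X_mul, coeff_C_mul, coeff_eq_zero_of_mem hD,
        L.coeff_Dx hmem]
      simp
  have c1 := coeff_mul_add_eq_of_natDegree_le (nd (L.Sx_mem hmem)) (nd (L.Sx_mem hmem))
  have c2 := coeff_mul_add_eq_of_natDegree_le (nd hYD) (nd hYD)
  have c3 := coeff_mul_add_eq_of_natDegree_le (nd (mem_degreeLT_succ hD))
    (nd (mem_degreeLT_succ hD))
  rw [L.coeff_Sx hmem] at c1
  rw [cYD] at c2
  rw [coeff_eq_zero_of_mem hD] at c3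
  have e : L.Sx w ^ 2 - L.U₂ * L.Dx w ^ 2 = L.Sx w * L.Sx w -
      C (L.alpha ^ 2 - 1) * ((L.Y * L.Dx w) * (L.Y * L.Dx w) -
        C (4 * L.c₁ * L.c₂) * (L.Dx w * L.Dx w)) := by
    rw [U₂_eq]
    simp only [map_sub, map_one, map_pow]
    ring
  intro h
  rw [e] at h
  have h' := congrArg (fun p => coeff p (n + n)) h
  simp only [coeff_sub, coeff_C_mul, c1, c2, c3, coeff_zero] at h'
  refine hc (pow_eq_zero_iff two_ne_zero |>.1 ?_)
  have := L.alphaSeq_sq n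
  linear_combination h' - w.coeff n ^ 2 * this

/-- If `d_n = 0`, then `w = D_x P_{n+1}` satisfies `L w = 0` and `L (w (z - c₃)) = 0` for the
operator `L f = φ D_x f + ψ S_x f`, which forces `φ = ψ = 0`. -/
theorem IsOPS.isAdmissible (L : QLattice) {φ ψ : ℂ[X]} (hP : IsOPS u P) (hφ : φ.natDegree ≤ 2)
    (hψ : ψ.natDegree ≤ 1) (hne : (φ, ψ) ≠ (0, 0)) (h : ∀ f, u (L.pearsonOp φ ψ f) = 0) :
    L.IsAdmissible φ ψ := by
  intro n hn
  have ha := L.alpha_ne_zero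
  have h1 (f g : ℂ[X]) :
      L.uIter φ ψ u 1 (f * L.Dx g) = L.alpha * u (g * L.pearsonOp φ ψ f) :=
    L.uIter_succ_mul_Dx h 0 f g
  obtain ⟨w, hw⟩ : ∃ w, w = L.Dx (P (n + 1)) := ⟨_, rfl⟩
  have hwm : w ∈ degreeLT ℂ (n + 1) := hw ▸ L.Dx_mem (hP.mem (n + 1))
  have hw0 : w ≠ 0 := by
    intro h0
    have := L.coeff_Dx (hP.mem (n + 1))
    rw [← hw, h0, coeff_zero] at this
    exact mul_ne_zero (L.gammaSeq_ne_zero (by omega)) (hP.coeff_ne_zero (n + 1)) this.symm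
  -- the coefficient of degree `n + 1` is a multiple of `d_n`
  have hLm : L.pearsonOp φ ψ w ∈ degreeLT ℂ (n + 1) := by
    have := L.sub_coeff_mul_Y_pow_mem (L.pearsonOp_mem hφ hψ hwm)
    rwa [L.coeff_pearsonOp hφ hψ hwm, hn, zero_mul, C_0, zero_mul, sub_zero] at this
  have hLw : L.pearsonOp φ ψ w = 0 := by
    refine hP.eq_zero hLm fun g hg => ?_
    -- `⟨u^{[1]}, w D_x g⟩` is symmetric in the two `x`-derivatives `w = D_x P_{n+1}` and `D_x g`
    have e1 := h1 w g
    have e2 := h1 (L.Dx g) (P (n + 1))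
    rw [hP.apply_mul_eq_zero (L.pearsonOp_mem hφ hψ (L.Dx_mem hg)), ← hw, mul_comm (L.Dx g), e1,
      mul_zero, mul_comm g] at e2
    exact (mul_eq_zero.1 e2).resolve_left ha
  -- `w u^{[1]} = 0`, because `D_x` is surjective
  have hw1 (g : ℂ[X]) : L.uIter φ ψ u 1 (w * g) = 0 := by
    obtain ⟨G, rfl⟩ := L.exists_Dx_eq g
    rw [h1, hLw, mul_zero, map_zero, mul_zero]
  have hLwY : L.pearsonOp φ ψ (w * L.Y) = 0 := by
    refine hP.eq_zero (mem_degreeLT_natDegree_succ _) fun g _ => ?_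
    have e := h1 (w * L.Y) g
    rw [mul_assoc, hw1, mul_comm g] at e
    exact (mul_eq_zero.1 e.symm).resolve_left ha
  rw [pearsonOp_apply] at hLw hLwY
  rw [Dx_mul, Sx_mul, Dx_Y, Sx_Y] at hLwY
  have hN := L.Sx_sq_sub_ne_zero hw0
  refine hne (Prod.ext ?_ ?_)
  · refine (mul_eq_zero.1 (?_ : φ * (L.Sx w ^ 2 - L.U₂ * L.Dx w ^ 2) = 0)).resolve_right hN
    linear_combination L.Sx w * hLwY - (L.U₂ * L.Dx w + C L.alpha * L.Y * L.Sx w) * hLw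
  · refine (mul_eq_zero.1 (?_ : ψ * (L.Sx w ^ 2 - L.U₂ * L.Dx w ^ 2) = 0)).resolve_right hN
    linear_combination -L.Dx w * hLwY + (L.Sx w + C L.alpha * L.Y * L.Dx w) * hLw

/-- For an admissible pair, the functional equation determines all moments from the zeroth one. -/
theorem apply_one_ne_zero (L : QLattice) {φ ψ : ℂ[X]} (hu : u ≠ 0) (hφ : φ.natDegree ≤ 2)
    (hψ : ψ.natDegree ≤ 1) (hd : L.IsAdmissible φ ψ) (h : ∀ f, u (L.pearsonOp φ ψ f) = 0) :
    u 1 ≠ 0 := by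
  intro h1
  have key (n : ℕ) : ∀ f ∈ degreeLT ℂ (n + 1), u f = 0 := by
    induction n with
    | zero =>
      intro f hf
      have := sub_eq_zero.1 (eq_zero_of_mem_degreeLT_zero (L.sub_coeff_mul_Y_pow_mem hf))
      rw [this, pow_zero, ← smul_eq_C_mul, map_smul, h1, smul_zero]
    | succ n ih =>
      intro f hf
      have hY := L.Y_pow_mem n.lt_succ_self
      have hc : (L.pearsonOp φ ψ (L.Y ^ n)).coeff (n + 1) ≠ 0 := by
        rw [L.coeff_pearsonOp hφ hψ hY, coeff_Y_pow, mul_one]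
        exact hd n
      have := ih _ (sub_C_div_mul_mem hf (L.pearsonOp_mem hφ hψ hY) hc)
      rwa [map_sub, ← smul_eq_C_mul, map_smul, h, smul_zero, sub_zero] at this
  exact hu (LinearMap.ext fun f => key _ f (mem_degreeLT_natDegree_succ f))

/-! ### The monic orthogonal polynomials and the regularity criterion -/

/-- The passage from `u^{[n]}` to `u^{[n+1]}` multiplies the zeroth moment by a factor that vanishes
exactly if the zero of `ψ^{[n]}` is a zero of `φ^{[n]}`. -/
theorem uIter_succ_one (L : QLattice) (hφ : φ.natDegree ≤ 2) (hψ : ψ.natDegree ≤ 1)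
    (hd : L.IsAdmissible φ ψ) (h : ∀ f, u (L.pearsonOp φ ψ f) = 0) (n : ℕ) :
    L.uIter φ ψ u (n + 1) 1 = -(L.alpha * L.d φ ψ (2 * n) / L.d φ ψ (2 * n + 1)) *
      (L.phiIter φ ψ n).eval (L.c₃ - L.e φ ψ n / L.d φ ψ (2 * n)) * L.uIter φ ψ u n 1 := by
  have h0 : L.d φ ψ (2 * n) ≠ 0 := by exact_mod_cast hd (2 * n)
  have h1 : L.d φ ψ (2 * n + 1) ≠ 0 := by exact_mod_cast hd (2 * n + 1)
  have hd1 := L.d_iter hφ hψ n 1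
  have eφ := eq_of_natDegree_le_two L.c₃ (L.natDegree_phiIter_le hφ hψ n)
  have eψ := L.psiIter_eq hφ hψ n
  have hc : (L.psiIter φ ψ n).coeff 1 = L.d φ ψ (2 * n) := by
    rw [eψ]; simp [coeff_X]
  rw [d, gammaSeq_one, alphaSeq_one, hc, add_comm 1] at hd1
  -- the functional equation gives two linear relations between the first three moments
  have E0 := L.uIter_pearsonOp h n 1
  have E1 := L.uIter_pearsonOp h n L.Y
  rw [uIter_succ_apply]
  rw [pearsonOp_apply, Dx_one, Sx_one, mul_zero, zero_add, mul_one] at E0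
  rw [pearsonOp_apply, Dx_Y, Sx_Y, mul_one] at E1
  rw [Dx_one, Sx_one, mul_zero, zero_add, mul_one]
  rw [← Y] at eφ eψ
  generalize L.uIter φ ψ u n = v at *
  generalize (L.phiIter φ ψ n).coeff 2 = a at *
  generalize (derivative (L.phiIter φ ψ n)).eval L.c₃ = b at *
  generalize (L.phiIter φ ψ n).eval L.c₃ = c at *
  rw [eφ] at E1 ⊢
  rw [← hd1] at h1 ⊢
  rw [eψ] at E0 E1
  generalize L.d φ ψ (2 * n) = d at *
  generalize L.e φ ψ n = e at *
  have vC (r : ℂ) (f : ℂ[X]) : v (C r * f) = r * v f := by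
    rw [← smul_eq_C_mul, map_smul, smul_eq_mul]
  have r0 : C d * L.Y + C e = C d * L.Y + C e * 1 := by ring
  have r1 : C a * L.Y ^ 2 + C b * L.Y + C c + (C d * L.Y + C e) * (C L.alpha * L.Y) =
      C (a + d * L.alpha) * L.Y ^ 2 + C (b + e * L.alpha) * L.Y + C c * 1 := by
    simp only [map_add, map_mul]; ring
  have r2 : C a * L.Y ^ 2 + C b * L.Y + C c = C a * L.Y ^ 2 + C b * L.Y + C c * 1 := by ring
  rw [r0] at E0
  rw [r1] at E1
  rw [r2]
  simp only [map_add v, vC] at E0 E1 ⊢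
  simp only [Y, eval_add, eval_mul, eval_C, eval_pow, eval_sub, eval_X, eval_one]
  rw [mul_one] at h1 ⊢
  have m1 : v L.Y = -(e / d) * v 1 := by
    field_simp
    linear_combination E0
  have m2 : v (L.Y ^ 2) = -((b + e * L.alpha) * v L.Y + c * v 1) / (a + d * L.alpha) := by
    rw [eq_div_iff h1]
    linear_combination E1
  obtain ⟨D, hD⟩ : ∃ D, D = a + d * L.alpha := ⟨_, rfl⟩
  rw [← Y, m2, m1, ← hD]
  rw [← hD] at h1
  field_simp
  rw [hD]
  ring

theorem rodriguesPoly_mem (L : QLattice) (hφ : φ.natDegree ≤ 2) (hψ : ψ.natDegree ≤ 1)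
    (k m : ℕ) : L.rodriguesPoly φ ψ k m ∈ degreeLT ℂ (m + 1) ∧
      (L.rodriguesPoly φ ψ k m).coeff m = L.rodriguesLead φ ψ k m := by
  induction m generalizing k with
  | zero =>
    refine ⟨?_, by simp [rodriguesPoly, rodriguesLead]⟩
    have := L.Y_pow_mem zero_lt_one
    rwa [pow_zero] at this
  | succ m ih =>
    have hφ' := L.natDegree_phiIter_le hφ hψ k
    have hψ' := L.natDegree_psiIter_le hφ hψ k
    rw [rodriguesPoly, rodriguesLead_succ, ← (ih (k + 1)).2, ← L.d_iter hφ hψ]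
    exact ⟨L.pearsonOp_mem hφ' hψ' (ih (k + 1)).1, L.coeff_pearsonOp hφ' hψ' (ih (k + 1)).1⟩

theorem rodriguesLead_ne_zero (L : QLattice) (hd : L.IsAdmissible φ ψ) (n : ℕ) :
    L.rodriguesLead φ ψ 0 n ≠ 0 := by
  refine Finset.prod_ne_zero_iff.2 fun j hj => ?_
  have hj := Finset.mem_range.1 hj
  rw [show (2 * (0 : ℕ) + n - 1 + j : ℤ) = ((n - 1 + j : ℕ) : ℤ) by omega]
  exact hd _

/-- The factor `d_{n-1} / d_{2n-1}` of `recC`, with its convention for `n = 0`, comes from the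
quotient of consecutive leading coefficients. -/
theorem rodriguesLead_mul (L : QLattice) (hd : L.IsAdmissible φ ψ) (n : ℕ) :
    L.rodriguesLead φ ψ 0 n * L.d φ ψ (2 * n) = L.rodriguesLead φ ψ 0 (n + 1) *
      (if n = 0 then 1 else L.d φ ψ (n - 1) / L.d φ ψ (2 * n - 1)) := by
  cases n with
  | zero => simp [rodriguesLead]
  | succ n =>
    have h0 : L.d φ ψ (2 * (n + 1 : ℕ) - 1) ≠ 0 := by
      rw [show (2 * (n + 1 : ℕ) - 1 : ℤ) = ((2 * n + 1 : ℕ) : ℤ) by omega]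
      exact hd _
    rw [if_neg n.succ_ne_zero, mul_div_assoc', eq_div_iff h0, rodriguesLead, rodriguesLead,
      Finset.prod_range_succ', Finset.prod_range_succ, Finset.prod_range_succ]
    have e (i : ℕ) : L.d φ ψ (2 * (0 : ℕ) + (n + 1 : ℕ) - 1 + (i + 1 : ℕ)) =
        L.d φ ψ (2 * (0 : ℕ) + (n + 1 + 1 : ℕ) - 1 + i) := by
      congr 1
      push_cast
      ring
    rw [Finset.prod_congr rfl fun i _ => e i,
      show (2 * (0 : ℕ) + (n + 1 : ℕ) - 1 + (0 : ℕ) : ℤ) = (n + 1 : ℕ) - 1 by push_cast; ring,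
      show (2 * (0 : ℕ) + (n + 1 + 1 : ℕ) - 1 + n : ℤ) = 2 * (n + 1 : ℕ) - 1 by push_cast; ring,
      show (2 * (0 : ℕ) + (n + 1 + 1 : ℕ) - 1 + (n + 1 : ℕ) : ℤ) = 2 * (n + 1 : ℕ) by
        push_cast; ring]
    ring

theorem rodriguesConst_eq (L : QLattice) (φ ψ : ℂ[X]) (n : ℕ) :
    L.rodriguesConst φ ψ n = ((-L.alpha) ^ n)⁻¹ * (L.rodriguesLead φ ψ 0 n)⁻¹ := by
  rw [rodriguesConst, rodriguesLead, Finset.prod_inv_distrib, Finset.range_eq_Ico,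
    ← Finset.Ico_add_one_right_eq_Icc, ← Finset.prod_Ico_add' _ 0 n 1]
  congr 2
  refine Finset.prod_congr rfl fun j _ => ?_
  congr 1
  push_cast
  ring

/-- The polynomial `R_n = rodriguesPoly 0 n`, divided by its leading coefficient; for a regular
functional, the monic orthogonal polynomial of degree `n`. -/
noncomputable def monicOPS (L : QLattice) (φ ψ : ℂ[X]) (n : ℕ) : ℂ[X] :=
  C (L.rodriguesLead φ ψ 0 n)⁻¹ * L.rodriguesPoly φ ψ 0 n

/-- The explicit value of `⟨u, P_n²⟩` for `P_n = monicOPS n`. -/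
noncomputable def sqNorm (L : QLattice) (φ ψ : ℂ[X]) (u : Module.Dual ℂ ℂ[X]) (n : ℕ) : ℂ :=
  (L.rodriguesLead φ ψ 0 n)⁻¹ * (L.alpha ^ n)⁻¹ *
    (∏ i ∈ Finset.range n, L.gammaSeq (i + 1)) * L.uIter φ ψ u n 1

theorem monicOPS_mem (L : QLattice) (hφ : φ.natDegree ≤ 2) (hψ : ψ.natDegree ≤ 1) (n : ℕ) :
    L.monicOPS φ ψ n ∈ degreeLT ℂ (n + 1) :=
  C_mul_mem_degreeLT _ (L.rodriguesPoly_mem hφ hψ 0 n).1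

theorem coeff_monicOPS (L : QLattice) (hφ : φ.natDegree ≤ 2) (hψ : ψ.natDegree ≤ 1)
    (hd : L.IsAdmissible φ ψ) (n : ℕ) : (L.monicOPS φ ψ n).coeff n = 1 := by
  rw [monicOPS, coeff_C_mul, (L.rodriguesPoly_mem hφ hψ 0 n).2,
    inv_mul_cancel₀ (L.rodriguesLead_ne_zero hd n)]

theorem apply_monicOPS_mul (L : QLattice) (h : ∀ f, u (L.pearsonOp φ ψ f) = 0) (n : ℕ)
    (f : ℂ[X]) : u (L.monicOPS φ ψ n * f) = (L.rodriguesLead φ ψ 0 n)⁻¹ * (L.alpha ^ n)⁻¹ *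
      L.uIter φ ψ u n ((L.Dx)^[n] f) := by
  rw [← L.apply_rodriguesPoly_mul h, mul_assoc _ (_ ^ n)⁻¹,
    inv_mul_cancel_left₀ (pow_ne_zero n L.alpha_ne_zero), monicOPS, mul_assoc, ← smul_eq_C_mul,
    map_smul, smul_eq_mul]

theorem apply_monicOPS_mul_eq_zero (L : QLattice) (h : ∀ f, u (L.pearsonOp φ ψ f) = 0) {n : ℕ}
    {f : ℂ[X]} (hf : f ∈ degreeLT ℂ n) : u (L.monicOPS φ ψ n * f) = 0 := by
  rw [L.apply_monicOPS_mul h, L.iterate_Dx_eq_zero hf, map_zero, mul_zero]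

theorem apply_monicOPS_mul_of_mem (L : QLattice) (h : ∀ f, u (L.pearsonOp φ ψ f) = 0) {n : ℕ}
    {f : ℂ[X]} (hf : f ∈ degreeLT ℂ (n + 1)) :
    u (L.monicOPS φ ψ n * f) = L.sqNorm φ ψ u n * f.coeff n := by
  rw [L.apply_monicOPS_mul h, L.iterate_Dx_eq_C hf, ← mul_one (C _), ← smul_eq_C_mul, map_smul,
    smul_eq_mul, sqNorm]
  ring

theorem sqNorm_succ (L : QLattice) (hφ : φ.natDegree ≤ 2) (hψ : ψ.natDegree ≤ 1)
    (hd : L.IsAdmissible φ ψ) (h : ∀ f, u (L.pearsonOp φ ψ f) = 0) (n : ℕ) :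
    L.sqNorm φ ψ u (n + 1) = L.recC φ ψ n * L.sqNorm φ ψ u n := by
  have h1 := L.rodriguesLead_ne_zero hd n
  have h2 := L.rodriguesLead_ne_zero hd (n + 1)
  have h3 := L.alpha_ne_zero
  have h4 := L.rodriguesLead_mul hd n
  have h5 : L.d φ ψ (2 * n + 1) ≠ 0 := by exact_mod_cast hd (2 * n + 1)
  rw [sqNorm, sqNorm, L.uIter_succ_one hφ hψ hd h, recC, Finset.prod_range_succ]
  generalize (L.phiIter φ ψ n).eval (L.c₃ - L.e φ ψ n / L.d φ ψ (2 * n)) = p at *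
  generalize (if n = 0 then 1 else L.d φ ψ (n - 1) / L.d φ ψ (2 * n - 1)) = r at *
  generalize L.d φ ψ (2 * n + 1) = d₁ at *
  generalize L.d φ ψ (2 * n) = d₀ at *
  generalize L.rodriguesLead φ ψ 0 n = l at *
  generalize L.rodriguesLead φ ψ 0 (n + 1) = l' at *
  field_simp
  linear_combination -((∏ i ∈ Finset.range n, L.gammaSeq (i + 1)) * L.gammaSeq (n + 1) *
    L.alpha * L.alpha ^ n * p * L.uIter φ ψ u n 1) * h4

theorem sqNorm_ne_zero_iff (L : QLattice) (hd : L.IsAdmissible φ ψ) (n : ℕ) :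
    L.sqNorm φ ψ u n ≠ 0 ↔ L.uIter φ ψ u n 1 ≠ 0 := by
  have h1 := L.rodriguesLead_ne_zero hd n
  have h3 := L.alpha_ne_zero
  have hp : ∏ i ∈ Finset.range n, L.gammaSeq (i + 1) ≠ 0 :=
    Finset.prod_ne_zero_iff.2 fun i _ => L.gammaSeq_ne_zero (by omega)
  simp [sqNorm, h1, h3, hp]

theorem IsOPS.sqNorm_ne_zero {P : ℕ → ℂ[X]} (hP : IsOPS u P) (L : QLattice)
    (hφ : φ.natDegree ≤ 2) (hψ : ψ.natDegree ≤ 1) (hd : L.IsAdmissible φ ψ)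
    (h : ∀ f, u (L.pearsonOp φ ψ f) = 0) (n : ℕ) : L.sqNorm φ ψ u n ≠ 0 := by
  have h1 := hP.apply_mul_ne_zero (L.monicOPS_mem hφ hψ n)
    (by rw [L.coeff_monicOPS hφ hψ hd]; exact one_ne_zero)
  rw [mul_comm, L.apply_monicOPS_mul_of_mem h (hP.mem n)] at h1
  exact left_ne_zero_of_mul h1

theorem isMonicOPS_monicOPS (L : QLattice) (hφ : φ.natDegree ≤ 2) (hψ : ψ.natDegree ≤ 1)
    (hd : L.IsAdmissible φ ψ) (h : ∀ f, u (L.pearsonOp φ ψ f) = 0)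
    (h0 : ∀ n, L.sqNorm φ ψ u n ≠ 0) : IsMonicOPS u (L.monicOPS φ ψ) := by
  have hc := L.coeff_monicOPS hφ hψ hd
  have hdeg (n : ℕ) : (L.monicOPS φ ψ n).degree = n := by
    refine degree_eq_of_le_of_coeff_ne_zero ?_ (by rw [hc]; exact one_ne_zero)
    have := L.monicOPS_mem hφ hψ n
    rw [mem_degreeLT] at this
    exact Order.lt_succ_iff.1 (by exact_mod_cast this)
  refine ⟨⟨hdeg, L.sqNorm φ ψ u, h0, fun n k => ?_⟩, fun n => ?_⟩
  · rcases lt_trichotomy n k with hnk | rfl | hnk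
    · rw [if_neg hnk.ne, mul_comm]
      exact L.apply_monicOPS_mul_eq_zero h (degreeLT_mono hnk (L.monicOPS_mem hφ hψ n))
    · rw [if_pos rfl, L.apply_monicOPS_mul_of_mem h (L.monicOPS_mem hφ hψ n), hc, mul_one]
    · rw [if_neg hnk.ne']
      exact L.apply_monicOPS_mul_eq_zero h (degreeLT_mono hnk (L.monicOPS_mem hφ hψ k))
  · rw [Monic, leadingCoeff, natDegree_eq_of_degree_eq_some (hdeg n), hc]

theorem monicOPS_zero (L : QLattice) (φ ψ : ℂ[X]) : L.monicOPS φ ψ 0 = 1 := by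
  simp [monicOPS, rodriguesLead, rodriguesPoly]

theorem monicOPS_sub_mem (L : QLattice) (hφ : φ.natDegree ≤ 2) (hψ : ψ.natDegree ≤ 1)
    (hd : L.IsAdmissible φ ψ) (m : ℕ) :
    L.monicOPS φ ψ (m + 1) - (L.Y ^ (m + 1) + C (L.gammaSeq (m + 1) * L.e φ ψ m /
      L.d φ ψ (2 * m)) * L.Y ^ m) ∈ degreeLT ℂ m := by
  have h1 := C_mul_mem_degreeLT (L.rodriguesLead φ ψ 0 (m + 1))⁻¹
    (L.rodriguesPoly_sub_mem hφ hψ hd 0 m)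
  rw [mul_sub, ← mul_assoc, ← C_mul, inv_mul_cancel₀ (L.rodriguesLead_ne_zero hd (m + 1)), C_1,
    one_mul] at h1
  simpa [monicOPS] using h1

theorem monicOPS_one (L : QLattice) (hφ : φ.natDegree ≤ 2) (hψ : ψ.natDegree ≤ 1)
    (hd : L.IsAdmissible φ ψ) :
    L.monicOPS φ ψ 1 = (X - C (L.recB φ ψ 0)) * L.monicOPS φ ψ 0 := by
  have h1 := L.monicOPS_sub_mem hφ hψ hd 0
  rw [sub_eq_zero.1 (eq_zero_of_mem_degreeLT_zero h1), monicOPS_zero, recB, Y]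
  simp only [Nat.cast_zero, zero_add, mul_zero, gammaSeq_zero, zero_mul, zero_div, add_zero,
    pow_one, pow_zero, mul_one, map_sub]
  ring

theorem monicOPS_add_two (L : QLattice) (hφ : φ.natDegree ≤ 2) (hψ : ψ.natDegree ≤ 1)
    (hd : L.IsAdmissible φ ψ) (h : ∀ f, u (L.pearsonOp φ ψ f) = 0)
    (h0 : ∀ n, L.sqNorm φ ψ u n ≠ 0) (n : ℕ) :
    L.monicOPS φ ψ (n + 2) = (X - C (L.recB φ ψ (n + 1))) * L.monicOPS φ ψ (n + 1) -
      C (L.recC φ ψ n) * L.monicOPS φ ψ n := by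
  have hP := (L.isMonicOPS_monicOPS hφ hψ hd h h0).1
  rw [← sub_eq_zero]
  have hmem : L.monicOPS φ ψ (n + 2) - ((X - C (L.recB φ ψ (n + 1))) * L.monicOPS φ ψ (n + 1) -
      C (L.recC φ ψ n) * L.monicOPS φ ψ n) ∈ degreeLT ℂ (n + 1) := by
    -- `recB (n + 1)` is `c₃` plus the difference of two consecutive subleading coefficients
    have h1 := L.monicOPS_sub_mem hφ hψ hd (n + 1)
    have h2 := L.monicOPS_sub_mem hφ hψ hd n
    have eB : L.recB φ ψ (n + 1) = L.c₃ + L.gammaSeq (n + 1) * L.e φ ψ n / L.d φ ψ (2 * n) -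
        L.gammaSeq ((n + 1 : ℕ) + 1) * L.e φ ψ (n + 1 : ℕ) / L.d φ ψ (2 * (n + 1 : ℕ)) := by
      rw [recB]
      congr 4
      · push_cast
        ring_nf
      · push_cast
        ring_nf
    rw [eB]
    generalize L.gammaSeq (n + 1) * L.e φ ψ n / L.d φ ψ (2 * n) = f₁ at *
    generalize L.gammaSeq ((n + 1 : ℕ) + 1) * L.e φ ψ (n + 1 : ℕ) /
      L.d φ ψ (2 * (n + 1 : ℕ)) = f₂ at *
    convert add_mem (add_mem (sub_mem h1 (L.Y_mul_mem h2))
      (C_mul_mem_degreeLT (f₁ - f₂) (add_mem (mem_degreeLT_succ h2)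
        (C_mul_mem_degreeLT f₁ (L.Y_pow_mem n.lt_succ_self)))))
      (C_mul_mem_degreeLT (L.recC φ ψ n) (L.monicOPS_mem hφ hψ n)) using 1
    simp only [Y, map_add, map_sub]
    ring
  -- only the coefficient of degree `n` of `g` contributes, and `sqNorm_succ` cancels it
  refine hP.eq_zero hmem fun g hg => ?_
  have hXg : X * g ∈ degreeLT ℂ (n + 1 + 1) := mul_mem_degreeLT natDegree_X_le hg
  have e : (L.monicOPS φ ψ (n + 2) - ((X - C (L.recB φ ψ (n + 1))) * L.monicOPS φ ψ (n + 1) -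
      C (L.recC φ ψ n) * L.monicOPS φ ψ n)) * g = L.monicOPS φ ψ (n + 2) * g -
      L.monicOPS φ ψ (n + 1) * (X * g) + L.recB φ ψ (n + 1) • (L.monicOPS φ ψ (n + 1) * g) +
      L.recC φ ψ n • (L.monicOPS φ ψ n * g) := by
    simp only [smul_eq_C_mul]
    ring
  rw [e, map_add, map_add, map_sub, map_smul, map_smul, hP.apply_mul_eq_zero (mem_degreeLT_succ hg),
    hP.apply_mul_eq_zero hg, L.apply_monicOPS_mul_of_mem h hXg,
    L.apply_monicOPS_mul_of_mem h hg, coeff_X_mul, L.sqNorm_succ hφ hψ hd h, smul_eq_mul,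
    smul_eq_mul]
  ring

theorem mulF_monicOPS (L : QLattice) (h : ∀ f, u (L.pearsonOp φ ψ f) = 0) (n : ℕ) :
    mulF (L.monicOPS φ ψ n) u =
      L.rodriguesConst φ ψ n • (L.DxF)^[n] (L.uIter φ ψ u n) := by
  have e := L.iterate_DxF_uIter h n 0
  rw [zero_add] at e
  rw [e, rodriguesConst_eq, smul_smul, mul_right_comm,
    inv_mul_cancel₀ (pow_ne_zero n (neg_ne_zero.2 L.alpha_ne_zero)), one_mul]
  refine LinearMap.ext fun f => ?_
  simp only [mulF, LinearMap.smul_apply, LinearMap.comp_apply, LinearMap.mulLeft_apply, uIter]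
  rw [← map_smul, smul_eq_C_mul, monicOPS, mul_assoc]

theorem psiIter_dvd_phiIter_iff (L : QLattice) (hφ : φ.natDegree ≤ 2) (hψ : ψ.natDegree ≤ 1)
    {n : ℕ} (hd : L.d φ ψ (2 * n) ≠ 0) : L.psiIter φ ψ n ∣ L.phiIter φ ψ n ↔
      (L.phiIter φ ψ n).eval (L.c₃ - L.e φ ψ n / L.d φ ψ (2 * n)) = 0 := by
  have e : L.psiIter φ ψ n =
      C (L.d φ ψ (2 * n)) * (X - C (L.c₃ - L.e φ ψ n / L.d φ ψ (2 * n))) := by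
    rw [L.psiIter_eq hφ hψ, C_sub, ← sub_add, mul_add, ← C_mul, mul_div_cancel₀ _ hd]
  rw [e, (isUnit_C.2 (isUnit_iff_ne_zero.2 hd)).mul_left_dvd, dvd_iff_isRoot, IsRoot.def]

theorem isRegular_iff (L : QLattice) (hu : u ≠ 0) (hφ : φ.natDegree ≤ 2) (hψ : ψ.natDegree ≤ 1)
    (hne : (φ, ψ) ≠ (0, 0)) (h : ∀ f, u (L.pearsonOp φ ψ f) = 0) :
    IsRegular u ↔ ∀ n : ℕ, L.d φ ψ n ≠ 0 ∧
      (L.phiIter φ ψ n).eval (L.c₃ - L.e φ ψ n / L.d φ ψ (2 * n)) ≠ 0 := by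
  constructor
  · rintro ⟨P, hP⟩ n
    have hd := hP.isAdmissible L hφ hψ hne h
    refine ⟨hd n, fun h0 => hP.sqNorm_ne_zero L hφ hψ hd h (n + 1) ?_⟩
    rw [L.sqNorm_succ hφ hψ hd h, recC, h0, mul_zero, zero_mul]
  · intro hn
    have hd : L.IsAdmissible φ ψ := fun n => (hn n).1
    refine ⟨_, (L.isMonicOPS_monicOPS hφ hψ hd h fun n => ?_).1⟩
    rw [L.sqNorm_ne_zero_iff hd]
    induction n with
    | zero => exact L.apply_one_ne_zero hu hφ hψ hd h
    | succ n ih =>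
      have h0 : L.d φ ψ (2 * n) ≠ 0 := by exact_mod_cast hd (2 * n)
      have h1 : L.d φ ψ (2 * n + 1) ≠ 0 := by exact_mod_cast hd (2 * n + 1)
      rw [L.uIter_succ_one hφ hψ hd h]
      exact mul_ne_zero (mul_ne_zero (neg_ne_zero.2
        (div_ne_zero (mul_ne_zero L.alpha_ne_zero h0) h1)) (hn n).2) ih

end QLattice

theorem mainTheorem1 (L : QLattice) (u : Module.Dual ℂ ℂ[X]) (hu : u ≠ 0)
    (φ ψ : ℂ[X]) (hφ : φ.natDegree ≤ 2) (hψ : ψ.natDegree ≤ 1) (hne : (φ, ψ) ≠ (0, 0))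
    (hGP : L.DxF (QLattice.mulF φ u) = L.SxF (QLattice.mulF ψ u)) :
    -- the closed forms of the iterated polynomials
    (∀ n : ℕ, L.phiIter φ ψ n = L.phiExplicit φ ψ n ∧ L.psiIter φ ψ n = L.psiExplicit φ ψ n) ∧
    -- the two regularity criteria
    (QLattice.IsRegular u ↔
      L.IsAdmissible φ ψ ∧ ∀ n : ℕ, ¬ L.psiIter φ ψ n ∣ L.phiIter φ ψ n) ∧
    (QLattice.IsRegular u ↔
      ∀ n : ℕ, L.d φ ψ n ≠ 0 ∧
        (L.phiIter φ ψ n).eval (L.c₃ - L.e φ ψ n / L.d φ ψ (2 * n)) ≠ 0) ∧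
    -- the monic orthogonal polynomial sequence: recurrence and Rodrigues formula
    (QLattice.IsRegular u →
      ∃ P : ℕ → ℂ[X], QLattice.IsMonicOPS u P ∧ (∀ Q, QLattice.IsMonicOPS u Q → Q = P) ∧
        P 1 = (X - C (L.recB φ ψ 0)) * P 0 ∧
        (∀ n : ℕ, P (n + 2) =
          (X - C (L.recB φ ψ (n + 1))) * P (n + 1) - C (L.recC φ ψ n) * P n) ∧
        ∀ n : ℕ, QLattice.mulF (P n) u =
          L.rodriguesConst φ ψ n • (L.DxF)^[n] (L.uIter φ ψ u n)) := by
  have h := L.apply_pearsonOp_eq_zero hGP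
  have hreg := L.isRegular_iff hu hφ hψ hne h
  refine ⟨L.phiIter_psiIter_eq_explicit hφ hψ, ?_, hreg, ?_⟩
  · rw [hreg, forall_and]
    refine and_congr_right fun hd => forall_congr' fun n => ?_
    rw [L.psiIter_dvd_phiIter_iff hφ hψ (by exact_mod_cast hd (2 * n))]
  · rintro ⟨P, hP⟩
    have hd := hP.isAdmissible L hφ hψ hne h
    have h0 := hP.sqNorm_ne_zero L hφ hψ hd h
    have hM := L.isMonicOPS_monicOPS hφ hψ hd h h0
    exact ⟨L.monicOPS φ ψ, hM, fun Q hQ => hM.unique hQ, L.monicOPS_one hφ hψ hd,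
      L.monicOPS_add_two hφ hψ hd h h0, L.mulF_monicOPS h⟩
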